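/- \textbf{Definitions.} An \emph{algebraic function field} $K/k$ is a finitely generated field extension; its \emph{field of constants} $k^c$ is the algebraic closure of $k$ in $K$. A \emph{covering diagram} of $K/k$ consists of fields $K_C$ and $K_B$ over $k$ and of finite field extensions $f: K\hookrightarrow K_C$ and $\pi: K_B(t)\hookrightarrow K_C$ over $k$, where $K_B(t)$ is the rational function field in one variable over $K_B$; its degree is $[K_C:K_B(t)]$. The \emph{covering gonality} $\mathrm{cvg}_k(K)$ is the minimal degree of a covering diagram of $K/k$, and the \emph{separable covering gonality} $\mathrm{scvg}_k(K)$ is the minimal degree of a covering diagram of $K/k$ for which $f$ is separable (both are $\infty$ if there is no such diagram, which happens only when $K/k$ is algebraic). A field extension $M/F$, not necessarily algebraic, is \emph{separable} if every finitely generated subextension $E/F$ is separably generated, i.e. $E$ is separable algebraic over $F(s)$ for some transcendence basis $s$ of $E/F$. \textbf{Proposition.} Let $K$ be an algebraic function field over a field $k$, let $L/k$ be an arbitrary field extension, and let $K'$ be a field of $K\otimes_k L$, i.e. the residue field $\mathrm{Frac}((K\otimes_k L)/\mathfrak p)$ at a minimal prime $\mathfrak p$ of $K\otimes_k L$, regarded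 as an extension of $K$ and of $L$. Then $$\mathrm{cvg}_k(K)=\mathrm{cvg}_L(K').$$ If moreover, inside some extension field $\Omega$ of $K'$, the field $L$ is contained in a separable extension of the field of constants $k^c$ of $K/k$ (i.e. there is a field $M$ with $k^c\subseteq M\subseteq\Omega$ and $L\subseteq M$ such that $M/k^c$ is separable, where $k^c\subseteq K$ and $L$ are viewed as subfields of $\Omega$ through $K'$), then $$\mathrm{scvg}_k(K)=\mathrm{scvg}_L(K').$$ -/

import Mathlib

open scoped TensorProduct IntermediateField

universe u v

/-- A covering diagram of the field extension `K/k`: a finite field extension `f : K → KC` over `k`,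
together with a finite extension `KB(t) → KC` over `k`, where `KB` is a field over `k` and `KB(t)`
is the field of rational functions in one variable over `KB`. The fields `KB` and `KB(t)` are
identified with their images in `KC`, so that `KB` is a subfield of `KC` containing `k` and `t` is
an element of `KC` transcendental over `KB`. -/
structure CoveringDiagram (k : Type u) (K : Type v) [Field k] [Field K] [Algebra k K] where
  /-- The field at the top of the diagram. -/
  KC : Type v
  [instField : Field KC]
  [instAlgebraBase : Algebra k KC]
  [instAlgebra : Algebra K KC]
  [instTower : IsScalarTower k K KC]
  /-- The extension `KC/K` is finite. -/
  finite_left : FiniteDimensional K KC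
  /-- The field `KB`, an extension of `k` inside `KC`. -/
  KB : IntermediateField k KC
  /-- The variable of the rational function field `KB(t)`. -/
  t : KC
  transcendental_t : Transcendental KB t
  /-- The extension `KC/KB(t)` is finite. -/
  finite_right : FiniteDimensional KB⟮t⟯ KC

attribute [instance] CoveringDiagram.instField CoveringDiagram.instAlgebraBase
  CoveringDiagram.instAlgebra CoveringDiagram.instTower

/-- The degree `[KC : KB(t)]` of a covering diagram. -/
noncomputable def CoveringDiagram.degree {k : Type u} {K : Type v} [Field k] [Field K]
    [Algebra k K] (D : CoveringDiagram k K) : ℕ :=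
  Module.finrank D.KB⟮D.t⟯ D.KC

/-- A covering diagram is separable if the finite extension `KC/K` is separable. -/
def CoveringDiagram.IsSeparable {k : Type u} {K : Type v} [Field k] [Field K]
    [Algebra k K] (D : CoveringDiagram k K) : Prop :=
  Algebra.IsSeparable K D.KC

/-- The covering gonality of `K/k`: the minimal degree of a covering diagram
(`⊤` if there is no covering diagram, which happens only if `K/k` is algebraic). -/
noncomputable def cvg (k : Type u) (K : Type v) [Field k] [Field K] [Algebra k K] : ℕ∞ :=
  ⨅ D : CoveringDiagram k K, (D.degree : ℕ∞)

/-- The separable covering gonality of `K/k`: the minimal degree of a separable covering diagram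
(`⊤` if there is none). -/
noncomputable def scvg (k : Type u) (K : Type v) [Field k] [Field K] [Algebra k K] : ℕ∞ :=
  ⨅ (D : CoveringDiagram k K) (_ : D.IsSeparable), (D.degree : ℕ∞)

/-- A field extension `M/F`, not necessarily algebraic, is separable if every finitely generated
subextension `E/F` is separably generated, that is, `E` has a transcendence basis `s` over `F` such
that `E` is separable algebraic over `F(s)`. -/
def IsSeparableExtension (F : Type u) (M : Type v) [Field F] [Field M] [Algebra F M] : Prop :=
  ∀ E : IntermediateField F M, E.FG →
    ∃ s : Set E, IsTranscendenceBasis F ((↑) : s → E) ∧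
      Algebra.IsSeparable (IntermediateField.adjoin F s) E

/-- The field `K'`, an extension of `K` and of `L` over `k`, is (with its embeddings of `K` and `L`)
the residue field of `K ⊗[k] L` at one of its minimal primes: the kernel of
`K ⊗[k] L → K'`, `x ⊗ y ↦ x * y`, is a minimal prime `p`, and `K'` is the field of fractions of the
image, which is `(K ⊗[k] L) / p`. -/
structure IsFieldOfTensorProduct (k K L K' : Type*) [Field k] [Field K] [Field L] [Field K']
    [Algebra k K] [Algebra k L] [Algebra k K'] [Algebra K K'] [Algebra L K']
    [IsScalarTower k K K'] [IsScalarTower k L K'] : Prop where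
  ker_mem_minimalPrimes :
    RingHom.ker (Algebra.TensorProduct.productMap (IsScalarTower.toAlgHom k K K')
      (IsScalarTower.toAlgHom k L K')) ∈ minimalPrimes (K ⊗[k] L)
  exists_div_eq : ∀ x : K', ∃ a b : K ⊗[k] L,
    x = Algebra.TensorProduct.productMap (IsScalarTower.toAlgHom k K K')
          (IsScalarTower.toAlgHom k L K') a /
        Algebra.TensorProduct.productMap (IsScalarTower.toAlgHom k K K')
          (IsScalarTower.toAlgHom k L K') b

/-!
The field `K'` is generated by `K` and `L`, and the minimality of the prime ideal means that `K` and
`L` are as independent over `k` as they can be: elements of `L` algebraically independent over `k`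
remain so over `K`, because `L` is flat over the polynomial ring they generate and minimal primes
consist of zero divisors (`IsFieldOfTensorProduct.algebraicIndependent_right`). By symmetry, a
transcendence basis of `K/k` is one of `K'/L`. Nothing else about the tensor product is used.

*Base change.* Given a covering diagram `K ⊆ KC ⊇ KB(t)` over `k`, the compositum of `KC` and `K'` is
finite over `K'` (separable if `KC/K` is) and is spanned over `(L·KB)(t)` by a basis of `KC/KB(t)`, so
that the degree does not grow. The element `t` stays transcendental, since otherwise the
transcendence degree of `K'/L` would be too small
(`IsFieldOfTensorProduct.exists_coveringDiagram_baseChange`).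

*Descent.* Given a covering diagram over `L`, fix a basis `e` of `KC` over `KB(t)`. The
multiplication table of `e` and the expansions of generators of `K` in terms of `e` involve only
finitely many elements, all of them algebraic over `K(X)` for a set `X` that is algebraically
independent over `K` and such that the part of `L` involved is algebraic over `k(X)`; a transcendence
basis of `L/k` has these properties.
Sending `X` to a general point with coordinates separable over `k` extends to a `K`-homomorphism `φ`
into an algebraic closure of `K`, defined at any prescribed finite set and nonzero at any prescribed
finite set of nonzero elements (`exists_specialization`). The image of the diagram under `φ` is a
covering diagram of `K/k` of at most the same degree, because `φ(e)` still spans. Again `φ(t)` is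
transcendental for reasons of transcendence degree: `KB` is algebraic over `L(z)` with `z` one element
short of a transcendence basis, and `φ(X)` is algebraic over `k`
(`exists_coveringDiagram_of_specialization`).

*Separability.* The specialization preserves separability of finitely many elements over `K(X)`: the
inverse of the derivative of an equation at a simple root is put in the domain of `φ`. Hence it
suffices that every finite part of `L` is separable over `K(X)`. If `L` lies in a separable extension
of the field of constants, then `X` is taken to be a separating transcendence basis, which is
algebraically independent over `K` by a count of transcendence degrees
(`IsFieldOfTensorProduct.exists_algebraicIndepOn_isSeparable`).
-/

open IntermediateField

/-! ### Algebraic and separable elements over varying base fields -/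

theorem IsSeparable.map_ringHom {A B E F : Type*} [Field A] [Field B] [Field E] [Field F]
    [Algebra A E] [Algebra B F] (i : A →+* B) (f : E →+* F)
    (h : (algebraMap B F).comp i = f.comp (algebraMap A E)) {a : E} (ha : IsSeparable A a) :
    IsSeparable B (f a) := by
  have h1 : Polynomial.aeval (f a) ((minpoly A a).map i) = 0 := by
    rw [← Polynomial.map_aeval_eq_aeval_map h, minpoly.aeval, map_zero]
  exact (Polynomial.Separable.map ha).of_dvd (minpoly.dvd _ _ h1)

theorem IsAlgebraic.map_ringHom {A B E F : Type*} [Field A] [Field B] [Field E] [Field F]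
    [Algebra A E] [Algebra B F] (i : A →+* B) (f : E →+* F)
    (h : (algebraMap B F).comp i = f.comp (algebraMap A E)) {a : E} (ha : IsAlgebraic A a) :
    IsAlgebraic B (f a) :=
  ha.ringHom_of_comp_eq i f i.injective h

namespace IntermediateField

variable {k V : Type*} [Field k] [Field V] [Algebra k V]

theorem isAlgebraic_of_algebraMap_mem {A : Type*} [Field A] [Algebra A V]
    (N : IntermediateField k V) (h : ∀ a, algebraMap A V a ∈ N) {x : V} (hx : IsAlgebraic A x) :
    IsAlgebraic N x :=
  IsAlgebraic.map_ringHom ((algebraMap A V).codRestrict N h) (RingHom.id V)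
    (RingHom.ext fun _ => rfl) hx

theorem isSeparable_of_algebraMap_mem {A : Type*} [Field A] [Algebra A V]
    (N : IntermediateField k V) (h : ∀ a, algebraMap A V a ∈ N) {x : V} (hx : IsSeparable A x) :
    IsSeparable N x :=
  IsSeparable.map_ringHom ((algebraMap A V).codRestrict N h) (RingHom.id V)
    (RingHom.ext fun _ => rfl) hx

theorem isAlgebraic_adjoin_image {E : Type*} [Field E] [Algebra k E] (f : E →ₐ[k] V) {s : Set E}
    {x : E} (hx : IsAlgebraic (adjoin k s) x) : IsAlgebraic (adjoin k (f '' s)) (f x) :=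
  have hle : adjoin k s ≤ (adjoin k (f '' s)).comap f :=
    adjoin_le_iff.2 fun y hy => subset_adjoin k _ ⟨y, hy, rfl⟩
  IsAlgebraic.map_ringHom (B := adjoin k (f '' s))
    ((f.toRingHom.comp (adjoin k s).val.toRingHom).codRestrict (adjoin k (f '' s))
      fun y => hle y.2) f.toRingHom (RingHom.ext fun _ => rfl) hx

theorem isSeparable_adjoin_image {E : Type*} [Field E] [Algebra k E] (f : E →ₐ[k] V) {s : Set E}
    {x : E} (hx : IsSeparable (adjoin k s) x) : IsSeparable (adjoin k (f '' s)) (f x) :=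
  have hle : adjoin k s ≤ (adjoin k (f '' s)).comap f :=
    adjoin_le_iff.2 fun y hy => subset_adjoin k _ ⟨y, hy, rfl⟩
  IsSeparable.map_ringHom (B := adjoin k (f '' s))
    ((f.toRingHom.comp (adjoin k s).val.toRingHom).codRestrict (adjoin k (f '' s))
      fun y => hle y.2) f.toRingHom (RingHom.ext fun _ => rfl) hx

theorem mem_adjoin_union_of_mem_adjoin_simple (B : IntermediateField k V) {t c : V}
    (hc : c ∈ B⟮t⟯) : c ∈ adjoin k ((B : Set V) ∪ {t}) := by
  induction hc using adjoin_induction with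
  | mem x hx => exact subset_adjoin k _ (Or.inr hx)
  | algebraMap x => exact subset_adjoin k _ (Or.inl x.2)
  | add x y _ _ hx hy => exact add_mem hx hy
  | inv x _ hx => exact inv_mem hx
  | mul x y _ _ hx hy => exact mul_mem hx hy

/-- Transitivity of algebraicity, for a base field `N` that need not be contained in `k(S)`. -/
theorem isAlgebraic_of_isAlgebraic_adjoin {N : Type*} [Field N] [Algebra k N] [Algebra N V]
    [IsScalarTower k N V] {S : Set V} (hS : ∀ s ∈ S, IsAlgebraic N s) {x : V}
    (hx : IsAlgebraic (adjoin k S) x) : IsAlgebraic N x := by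
  have hle : adjoin k S ≤ (algebraicClosure N V).restrictScalars k :=
    adjoin_le_iff.2 fun s hs => mem_algebraicClosure_iff.2 (hS s hs)
  have : IsAlgebraic (algebraicClosure N V) x :=
    IsAlgebraic.map_ringHom (B := algebraicClosure N V) (inclusion hle).toRingHom (RingHom.id V)
      (RingHom.ext fun _ => rfl) hx
  exact this.restrictScalars N

/-- Transitivity of separability, for a base field `N` that need not be contained in `k(S)`. -/
theorem isSeparable_of_isSeparable_adjoin {N : Type*} [Field N] [Algebra k N] [Algebra N V]
    [IsScalarTower k N V] {S : Set V} (hS : ∀ s ∈ S, IsSeparable N s) {x : V}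
    (hx : IsSeparable (adjoin k S) x) : IsSeparable N x := by
  have hle : adjoin k S ≤ (separableClosure N V).restrictScalars k :=
    adjoin_le_iff.2 fun s hs => mem_separableClosure_iff.2 (hS s hs)
  have : IsSeparable (separableClosure N V) x :=
    IsSeparable.map_ringHom (B := separableClosure N V) (inclusion hle).toRingHom (RingHom.id V)
      (RingHom.ext fun _ => rfl) hx
  exact IsSeparable.of_algebra_isSeparable_of_isSeparable N this

theorem isAlgebraic_adjoin_mono {S T : Set V} (h : S ⊆ T) {x : V}
    (hx : IsAlgebraic (adjoin k S) x) : IsAlgebraic (adjoin k T) x :=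
  isAlgebraic_of_isAlgebraic_adjoin (N := adjoin k T) (fun s hs =>
    isAlgebraic_algebraMap (⟨s, subset_adjoin k T (h hs)⟩ : adjoin k T)) hx

theorem isSeparable_adjoin_mono {S T : Set V} (h : S ⊆ T) {x : V}
    (hx : IsSeparable (adjoin k S) x) : IsSeparable (adjoin k T) x :=
  isSeparable_of_isSeparable_adjoin (N := adjoin k T) (fun s hs =>
    isSeparable_algebraMap (⟨s, subset_adjoin k T (h hs)⟩ : adjoin k T)) hx

theorem isAlgebraic_of_mem_adjoin {N : Type*} [Field N] [Algebra k N] [Algebra N V]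
    [IsScalarTower k N V] {S : Set V} (hS : ∀ s ∈ S, IsAlgebraic N s) {x : V}
    (hx : x ∈ adjoin k S) : IsAlgebraic N x :=
  isAlgebraic_of_isAlgebraic_adjoin hS (isAlgebraic_algebraMap (⟨x, hx⟩ : adjoin k S))

theorem exists_finset_subset_adjoin {S C : Set V} (hC : C.Finite) (h : C ⊆ adjoin k S) :
    ∃ T : Finset V, (T : Set V) ⊆ S ∧ C ⊆ adjoin k (T : Set V) := by
  classical
  induction C, hC using Set.Finite.induction_on with
  | empty => exact ⟨∅, by simp, by simp⟩
  | @insert c C _ _ ih =>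
    obtain ⟨T, hT, hCT⟩ := ih ((Set.subset_insert _ _).trans h)
    obtain ⟨T', hT', hc⟩ := exists_finset_of_mem_adjoin (h (Set.mem_insert c C))
    refine ⟨T ∪ T', by simp [hT, hT'], Set.insert_subset ?_ ?_⟩
    · exact adjoin.mono _ _ _ (by simp) hc
    · exact hCT.trans (adjoin.mono k _ _ (by simp))

/-- A polynomial over `k(S)` has coefficients in `k(T)` for some finite `T ⊆ S`. -/
theorem exists_finset_polynomial {S : Set V} (p : Polynomial (adjoin k S)) :
    ∃ T : Finset V, (T : Set V) ⊆ S ∧ ∃ q : Polynomial (adjoin k (T : Set V)),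
      q.map (algebraMap _ V) = p.map (algebraMap _ V) := by
  obtain ⟨T, hT, hp⟩ := exists_finset_subset_adjoin (k := k) (S := S)
    (C := (p.map (algebraMap _ V)).coeffs) (Finset.finite_toSet _) (by
      intro c hc
      obtain ⟨n, -, rfl⟩ := Polynomial.mem_coeffs_iff.1 hc
      rw [Polynomial.coeff_map]
      exact (p.coeff n).2)
  refine ⟨T, hT, (Polynomial.mem_lifts _).1 ((Polynomial.lifts_iff_coeff_lifts _).2 fun n => ?_)⟩
  by_cases hn : (p.map (algebraMap _ V)).coeff n = 0
  · rw [hn]; exact ⟨0, map_zero _⟩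
  · exact ⟨⟨_, hp (Polynomial.coeff_mem_coeffs hn)⟩, rfl⟩

theorem exists_finset_isAlgebraic_adjoin {S : Set V} {x : V} (hx : IsAlgebraic (adjoin k S) x) :
    ∃ T : Finset V, (T : Set V) ⊆ S ∧ IsAlgebraic (adjoin k (T : Set V)) x := by
  obtain ⟨p, hp, hpx⟩ := hx
  obtain ⟨T, hT, q, hq⟩ := exists_finset_polynomial p
  refine ⟨T, hT, q, fun h => hp ?_, ?_⟩
  · rw [h, Polynomial.map_zero] at hq
    exact (Polynomial.map_eq_zero _).1 hq.symm
  · rw [← Polynomial.aeval_map_algebraMap V, hq, Polynomial.aeval_map_algebraMap, hpx]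

theorem exists_finset_isSeparable_adjoin {S : Set V} {x : V} (hx : IsSeparable (adjoin k S) x) :
    ∃ T : Finset V, (T : Set V) ⊆ S ∧ IsSeparable (adjoin k (T : Set V)) x := by
  obtain ⟨T, hT, q, hq⟩ := exists_finset_polynomial (minpoly (adjoin k S) x)
  have h1 : Polynomial.aeval x q = 0 := by
    rw [← Polynomial.aeval_map_algebraMap V, hq, Polynomial.aeval_map_algebraMap, minpoly.aeval]
  have h2 : q.Separable := by
    rw [← Polynomial.separable_map (algebraMap _ V), hq, Polynomial.separable_map]
    exact hx
  exact ⟨T, hT, h2.of_dvd (minpoly.dvd _ _ h1)⟩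

theorem isAlgebraic_algebra_adjoin_iff {S : Set V} {x : V} :
    IsAlgebraic (Algebra.adjoin k S) x ↔ IsAlgebraic (adjoin k S) x :=
  open scoped algebraAdjoinAdjoin in
  IsFractionRing.isAlgebraic_iff (Algebra.adjoin k S) (adjoin k S) V

/-! ### Counting transcendence degrees -/

/-- The closure of `S` in the matroid of algebraic independence consists of the elements algebraic
over the field `k(S)`. -/
theorem mem_matroid_closure_iff {S : Set V} {x : V} :
    x ∈ (AlgebraicIndependent.matroid k V).closure S ↔ IsAlgebraic (adjoin k S) x := by
  rw [AlgebraicIndependent.matroid_closure_eq, ← isAlgebraic_algebra_adjoin_iff]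
  rfl

/-- An algebraically independent set that is algebraic over `k(Z)` has at most as many elements
as `Z`. -/
theorem encard_le_of_isAlgebraic_adjoin {s Z : Set V} (hs : AlgebraicIndepOn k id s)
    (h : ∀ x ∈ s, IsAlgebraic (adjoin k Z) x) : s.encard ≤ Z.encard := by
  let M := AlgebraicIndependent.matroid k V
  have h1 : M.Indep s := AlgebraicIndependent.matroid_indep_iff.2 hs
  calc s.encard ≤ M.eRk (M.closure Z) :=
        h1.encard_le_eRk_of_subset fun x hx => mem_matroid_closure_iff.2 (h x hx)
    _ = M.eRk Z := M.eRk_closure_eq Z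
    _ ≤ Z.encard := M.eRk_le_encard Z

/-- A finite set `X` is algebraically independent if some algebraically independent set with at least
as many elements is algebraic over `k(X)`. -/
theorem algebraicIndepOn_of_encard_le {X Y : Set V} (hX : X.Finite) (hY : AlgebraicIndepOn k id Y)
    (h : ∀ y ∈ Y, IsAlgebraic (adjoin k X) y) (hXY : X.encard ≤ Y.encard) :
    AlgebraicIndepOn k id X := by
  let M := AlgebraicIndependent.matroid k V
  have h1 : M.Indep Y := AlgebraicIndependent.matroid_indep_iff.2 hY
  refine AlgebraicIndependent.matroid_indep_iff.1 ((Matroid.indep_iff_eRk_eq_encard_of_finite hX).2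
    (le_antisymm (M.eRk_le_encard X) ?_))
  calc X.encard ≤ Y.encard := hXY
    _ ≤ M.eRk (M.closure X) :=
        h1.encard_le_eRk_of_subset fun x hx => mem_matroid_closure_iff.2 (h x hx)
    _ = M.eRk X := M.eRk_closure_eq X

end IntermediateField

theorem AlgebraicIndepOn.image_algHom {k E V : Type*} [Field k] [Field E] [Field V] [Algebra k E]
    [Algebra k V] (f : E →ₐ[k] V) {s : Set E} (hs : AlgebraicIndepOn k id s) :
    AlgebraicIndepOn k id (f '' s) := by
  have h1 := AlgebraicIndependent.map' hs (f := f) f.injective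
  have h2 := h1.to_subtype_range
  have h3 : Set.range (f ∘ fun x : s => id (x : E)) = f '' s := by
    ext; simp
  rw [h3] at h2
  exact h2

/-- In a covering diagram `k ⊆ KB ⊆ KB(t) ⊆ KC ⊇ K`, a transcendence basis of `KB` over `k` has
one element less than a transcendence basis of `K` over `k`. -/
theorem CoveringDiagram.exists_encard_add_one_eq {k K : Type*} [Field k] [Field K] [Algebra k K]
    (D : CoveringDiagram k K) {s : Set K} (hs : IsTranscendenceBasis k ((↑) : s → K)) :
    ∃ z : Set D.KC, z ⊆ D.KB ∧ (∀ b ∈ D.KB, IsAlgebraic (adjoin k z) b) ∧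
      z.encard + 1 = s.encard := by
  obtain ⟨z₀, hz₀⟩ := exists_isTranscendenceBasis k D.KB
  let z : Set D.KC := D.KB.val '' z₀
  have hzB : z ⊆ D.KB := by rintro _ ⟨x, -, rfl⟩; exact x.2
  have hz : AlgebraicIndepOn k id z := AlgebraicIndepOn.image_algHom D.KB.val hz₀.1
  have halg : ∀ b ∈ D.KB, IsAlgebraic (adjoin k z) b := by
    intro b hb
    have h1 := hz₀.isAlgebraic
    rw [Subtype.range_coe] at h1
    have h1 := isAlgebraic_algebra_adjoin_iff.1 (h1.isAlgebraic ⟨b, hb⟩)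
    exact isAlgebraic_adjoin_image D.KB.val h1
  have htz : ¬ IsAlgebraic (adjoin k z) D.t := fun h =>
    D.transcendental_t (isAlgebraic_of_isAlgebraic_adjoin (N := D.KB) (fun x hx =>
      isAlgebraic_algebraMap (⟨x, hzB hx⟩ : D.KB)) h)
  have htz' : D.t ∉ z := fun h =>
    htz (isAlgebraic_algebraMap (⟨D.t, subset_adjoin k z h⟩ : adjoin k z))
  have hins : AlgebraicIndepOn k id (insert D.t z) :=
    (AlgebraicIndepOn.insert_iff htz').2 ⟨hz, by
      rw [Set.image_id]; exact fun h => htz (isAlgebraic_algebra_adjoin_iff.1 h)⟩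
  refine ⟨z, hzB, halg, ?_⟩
  rw [← Set.encard_insert_of_notMem htz']
  let f : K →ₐ[k] D.KC := IsScalarTower.toAlgHom k K D.KC
  have hfs : (f '' s).encard = s.encard := f.injective.encard_image s
  rw [← hfs]
  apply le_antisymm
  · refine encard_le_of_isAlgebraic_adjoin hins fun x _ => ?_
    have := D.finite_left
    have h0 : IsAlgebraic K x := Algebra.IsAlgebraic.isAlgebraic x
    have h1 : ∀ y : K, IsAlgebraic (adjoin k (f '' s)) (f y) := by
      intro y
      have h1 := hs.isAlgebraic
      rw [Subtype.range_coe] at h1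
      have h1 := isAlgebraic_algebra_adjoin_iff.1 (h1.isAlgebraic y)
      exact isAlgebraic_adjoin_image f h1
    have h2 : IsAlgebraic (adjoin k (Set.range f)) x :=
      isAlgebraic_of_algebraMap_mem (A := K) _
        (fun y => subset_adjoin k (Set.range f) (Set.mem_range_self y)) h0
    exact isAlgebraic_of_isAlgebraic_adjoin (N := adjoin k (f '' s))
      (by rintro _ ⟨y, rfl⟩; exact h1 y) h2
  · refine encard_le_of_isAlgebraic_adjoin (AlgebraicIndepOn.image_algHom f hs.1) fun x _ => ?_
    have := D.finite_right
    have h0 : IsAlgebraic D.KB⟮D.t⟯ x := Algebra.IsAlgebraic.isAlgebraic x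
    have hN : ∀ b ∈ D.KB, IsAlgebraic (adjoin k (insert D.t z)) b := fun b hb =>
      isAlgebraic_adjoin_mono (Set.subset_insert _ _) (halg b hb)
    have h2 : IsAlgebraic (adjoin k ((D.KB : Set D.KC) ∪ {D.t})) x :=
      isAlgebraic_of_algebraMap_mem (A := D.KB⟮D.t⟯) _
        (fun y => mem_adjoin_union_of_mem_adjoin_simple _ y.2) h0
    refine isAlgebraic_of_isAlgebraic_adjoin (N := adjoin k (insert D.t z)) ?_ h2
    rintro b (hb | rfl)
    · exact hN b hb
    · exact isAlgebraic_algebraMap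
        (⟨D.t, subset_adjoin k _ (Set.mem_insert _ _)⟩ : adjoin k (insert D.t z))

/-! ### Constructing covering diagrams -/

/-- The span of a finite family that contains `1` and all products of two of its members in its
span is a field. -/
theorem exists_intermediateField_eq_span {F E ι : Type*} [Field F] [Field E] [Algebra F E]
    [Finite ι] (e : ι → E) (h1 : (1 : E) ∈ Submodule.span F (Set.range e))
    (hmul : ∀ i j, e i * e j ∈ Submodule.span F (Set.range e)) :
    ∃ W : IntermediateField F E, (∀ x ∈ W, IsAlgebraic F x) ∧
      ∀ x, x ∈ W ↔ x ∈ Submodule.span F (Set.range e) := by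
  let M := Submodule.span F (Set.range e)
  have hM : ∀ x y, x ∈ M → y ∈ M → x * y ∈ M := by
    intro x y hx hy
    induction hx, hy using Submodule.span_induction₂ with
    | mem_mem x y hx hy => obtain ⟨i, rfl⟩ := hx; obtain ⟨j, rfl⟩ := hy; exact hmul i j
    | zero_left y hy => rw [zero_mul]; exact M.zero_mem
    | zero_right x hx => rw [mul_zero]; exact M.zero_mem
    | add_left x y z _ _ _ h h' => rw [add_mul]; exact M.add_mem h h'
    | add_right x y z _ _ _ h h' => rw [mul_add]; exact M.add_mem h h'
    | smul_left r x y _ _ h => rw [smul_mul_assoc]; exact M.smul_mem r h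
    | smul_right r x y _ _ h => rw [mul_smul_comm]; exact M.smul_mem r h
  let S : Subalgebra F E := M.toSubalgebra h1 hM
  have : FiniteDimensional F M := FiniteDimensional.span_of_finite F (Set.finite_range e)
  have hfin : FiniteDimensional F S := this
  have hS : IsField S := isField_of_isIntegral_of_isField' (Field.toIsField F)
  refine ⟨S.toIntermediateField' hS, fun x hx => ?_, fun x => Iff.rfl⟩
  exact (IsIntegral.map S.val (Algebra.IsIntegral.isIntegral (R := F) (⟨x, hx⟩ : S))).isAlgebraic

theorem finrank_le_of_algebraMap_mem_span {F C E ι : Type*} [Field F] [Field C] [Field E]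
    [Algebra F C] [Algebra C E] [Algebra F E] [IsScalarTower F C E] [Fintype ι] (e : ι → E)
    (h : ∀ x : C, algebraMap C E x ∈ Submodule.span F (Set.range e)) :
    FiniteDimensional F C ∧ Module.finrank F C ≤ Fintype.card ι := by
  let M := Submodule.span F (Set.range e)
  have hM : FiniteDimensional F M := FiniteDimensional.span_of_finite F (Set.finite_range e)
  let g : C →ₗ[F] M := LinearMap.codRestrict M (IsScalarTower.toAlgHom F C E).toLinearMap h
  have hg : Function.Injective g := fun x y hxy =>
    (algebraMap C E).injective (congrArg Subtype.val hxy)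
  exact ⟨FiniteDimensional.of_injective g hg,
    (LinearMap.finrank_le_finrank_of_injective hg).trans (finrank_range_le_card e)⟩

/-- A covering diagram can be read off inside any field extension `Ω` of `K`. -/
theorem CoveringDiagram.exists_degree_le {k : Type*} {K Ω : Type v} [Field k] [Field K] [Field Ω]
    [Algebra k K] [Algebra K Ω] [Algebra k Ω] [IsScalarTower k K Ω]
    (KC : IntermediateField K Ω) [FiniteDimensional K KC] (B : IntermediateField k Ω)
    (hB : ∀ x ∈ B, x ∈ KC) {t : Ω} (ht : t ∈ KC) (htr : Transcendental B t)
    {ι : Type*} [Fintype ι] (e : ι → Ω)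
    (hspan : ∀ x ∈ KC, x ∈ Submodule.span B⟮t⟯ (Set.range e)) :
    ∃ D : CoveringDiagram k K, D.degree ≤ Fintype.card ι ∧
      (Algebra.IsSeparable K KC → D.IsSeparable) := by
  let B' : IntermediateField k KC := B.comap (KC.val.restrictScalars k)
  let t' : KC := ⟨t, ht⟩
  let N := B'⟮t'⟯
  have hN : ∀ c ∈ B⟮t⟯, ∃ n : N, algebraMap N Ω n = c := by
    intro c hc
    induction hc using adjoin_induction with
    | mem x hx =>
      obtain rfl := hx
      exact ⟨⟨t', mem_adjoin_simple_self _ _⟩, rfl⟩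
    | algebraMap x => exact ⟨algebraMap B' N ⟨⟨x, hB _ x.2⟩, (x.2 : (x : Ω) ∈ B)⟩, rfl⟩
    | add x y _ _ hx hy =>
      obtain ⟨a, rfl⟩ := hx; obtain ⟨b, rfl⟩ := hy; exact ⟨a + b, map_add _ _ _⟩
    | inv x _ hx => obtain ⟨a, rfl⟩ := hx; exact ⟨a⁻¹, map_inv₀ _ _⟩
    | mul x y _ _ hx hy =>
      obtain ⟨a, rfl⟩ := hx; obtain ⟨b, rfl⟩ := hy; exact ⟨a * b, map_mul _ _ _⟩
  let M : Submodule N Ω := Submodule.span N (Set.range e)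
  have hM : ∀ x ∈ KC, x ∈ M := by
    intro x hx
    have hxB := hspan x hx
    clear hx
    induction hxB using Submodule.span_induction with
    | mem x hx => exact Submodule.subset_span hx
    | zero => exact M.zero_mem
    | add x y _ _ hx hy => exact M.add_mem hx hy
    | smul c x _ hx =>
      obtain ⟨n, hn⟩ := hN c c.2
      have : c • x = n • x := by
        rw [Algebra.smul_def, Algebra.smul_def, hn]; rfl
      rw [this]
      exact M.smul_mem n hx
  have hfin := finrank_le_of_algebraMap_mem_span (F := N) (C := KC) e fun x => hM _ x.2
  refine ⟨{ KC := KC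
            instField := inferInstance
            instAlgebraBase := inferInstance
            instAlgebra := inferInstance
            instTower := inferInstance
            finite_left := inferInstance
            KB := B'
            t := t'
            transcendental_t := ?_
            finite_right := hfin.1 }, ?_, fun h => h⟩
  · intro h
    exact htr (isAlgebraic_of_algebraMap_mem (A := B') B (fun a => (a.2 : ((a : KC) : Ω) ∈ B))
      (IsAlgebraic.map_ringHom (RingHom.id B') (algebraMap KC Ω) (RingHom.ext fun _ => rfl) h))
  · exact hfin.2

/-! ### Extending homomorphisms to algebraically closed fields -/

/-- A local homomorphism to an algebraically closed field extends along an integral extension: some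
maximal ideal lies over the maximal ideal, and the residue field extension is algebraic. -/
theorem IsLocalRing.exists_ringHom_extension_of_isIntegral {B C Ω : Type*} [CommRing B]
    [IsLocalRing B] [CommRing C] [Nontrivial C] [Algebra B C] [Algebra.IsIntegral B C] [Field Ω]
    [IsAlgClosed Ω] (ψ : B →+* Ω) [IsLocalHom ψ] :
    ∃ φ : C →+* Ω, φ.comp (algebraMap B C) = ψ := by
  obtain ⟨Q, hQ, hQB⟩ := Ideal.exists_ideal_over_maximal_of_isIntegral (S := C)
    (IsLocalRing.maximalIdeal B) (IsLocalRing.le_maximalIdeal (by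
      rw [Ne, Ideal.eq_top_iff_one, RingHom.mem_ker, map_one]; exact one_ne_zero))
  let _ : Field (C ⧸ Q) := Ideal.Quotient.field Q
  let i : IsLocalRing.ResidueField B →+* C ⧸ Q :=
    Ideal.quotientMap Q (algebraMap B C) hQB.ge
  let _ : Algebra (IsLocalRing.ResidueField B) (C ⧸ Q) := i.toAlgebra
  let _ : Algebra (IsLocalRing.ResidueField B) Ω := (IsLocalRing.ResidueField.lift ψ).toAlgebra
  have hi : i.IsIntegral := by
    intro x
    obtain ⟨c, rfl⟩ := Ideal.Quotient.mk_surjective x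
    obtain ⟨p, hp, hpc⟩ := Algebra.IsIntegral.isIntegral (R := B) c
    refine ⟨p.map (IsLocalRing.residue B), hp.map _, ?_⟩
    rw [Polynomial.eval₂_map]
    have : i.comp (IsLocalRing.residue B) = (Ideal.Quotient.mk Q).comp (algebraMap B C) := rfl
    rw [this, ← Polynomial.hom_eval₂, hpc, map_zero]
  have : Algebra.IsIntegral (IsLocalRing.ResidueField B) (C ⧸ Q) := ⟨hi⟩
  let l : (C ⧸ Q) →ₐ[IsLocalRing.ResidueField B] Ω := IsAlgClosed.lift
  exact ⟨l.toRingHom.comp (Ideal.Quotient.mk Q), RingHom.ext fun b =>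
    l.commutes (IsLocalRing.residue B b)⟩

/-- Let `A` be a subring of a field `E`, and `φ₀` a homomorphism from `A` to an algebraically closed
field. Then `φ₀` extends to a subring of `E` that contains every root in `E` of a polynomial over
`A` whose leading coefficient is not killed by `φ₀`. -/
theorem exists_ringHom_extension {A E Ω : Type*} [CommRing A] [Field E] [Field Ω] [IsAlgClosed Ω]
    [Algebra A E] [FaithfulSMul A E] (φ₀ : A →+* Ω) :
    ∃ (S : Subalgebra A E) (φ : S →+* Ω), φ.comp (algebraMap A S) = φ₀ ∧
      ∀ (x : E) (p : Polynomial A), Polynomial.aeval x p = 0 → φ₀ p.leadingCoeff ≠ 0 → x ∈ S := by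
  have hinj : Function.Injective (algebraMap A E) := FaithfulSMul.algebraMap_injective A E
  let P := RingHom.ker φ₀
  have hP : P.IsPrime := RingHom.ker_isPrime φ₀
  let B := Localization.AtPrime P
  have hu : ∀ y : P.primeCompl, IsUnit (algebraMap A E y) := fun y =>
    IsUnit.mk0 _ fun h => y.2 (by
      rw [(map_eq_zero_iff _ hinj).1 h]; exact P.zero_mem)
  let j : B →+* E := IsLocalization.lift (M := P.primeCompl) hu
  let _ : Algebra B E := j.toAlgebra
  have : IsScalarTower A B E := IsScalarTower.of_algebraMap_eq fun x =>
    (IsLocalization.lift_eq hu x).symm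
  have hu' : ∀ y : P.primeCompl, IsUnit (φ₀ y) := fun y => IsUnit.mk0 _ fun h => y.2 h
  let ψ : B →+* Ω := IsLocalization.lift (M := P.primeCompl) hu'
  have hψ : ∀ a, ψ (algebraMap A B a) = φ₀ a := fun a => IsLocalization.lift_eq hu' a
  have : IsLocalHom ψ := by
    refine ⟨fun b hb => ?_⟩
    obtain ⟨⟨a, s⟩, rfl⟩ := IsLocalization.mk'_surjective P.primeCompl b
    rw [IsLocalization.AtPrime.isUnit_mk'_iff B P]
    intro ha
    refine hb.ne_zero ?_
    change ψ (IsLocalization.mk' B a s) = 0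
    rw [IsLocalization.lift_mk'_spec, mul_zero]
    exact ha
  let C := integralClosure B E
  obtain ⟨φ, hφψ⟩ := IsLocalRing.exists_ringHom_extension_of_isIntegral (C := C) ψ
  have hφ : ∀ b : B, φ (algebraMap B C b) = ψ b := fun b => RingHom.congr_fun hφψ b
  refine ⟨C.restrictScalars A, φ, RingHom.ext fun a => ?_, fun x p hp hlc => ?_⟩
  · rw [← hψ, ← hφ]
    refine congrArg φ (Subtype.ext ?_)
    exact IsScalarTower.algebraMap_apply A B E a
  · change IsIntegral B x
    have h1 : IsIntegral A (p.leadingCoeff • x) := isIntegral_leadingCoeff_smul p x hp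
    have h2 : IsIntegral B (p.leadingCoeff • x) := h1.tower_top
    obtain ⟨u, hu⟩ := IsLocalization.map_units B (⟨p.leadingCoeff, hlc⟩ : P.primeCompl)
    have h3 : x = (↑u⁻¹ : B) • (p.leadingCoeff • x) := by
      rw [← algebraMap_smul B p.leadingCoeff x, smul_smul]
      change x = (↑u⁻¹ * algebraMap A B (⟨p.leadingCoeff, hlc⟩ : P.primeCompl)) • x
      rw [← hu, Units.inv_mul, one_smul]
    rw [h3]
    exact h2.smul _

/-! ### Specializations -/

theorem isSeparable_of_aeval_derivative_ne_zero {F E : Type*} [Field F] [Field E] [Algebra F E]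
    {x : E} {q : Polynomial F} (h0 : Polynomial.aeval x q = 0)
    (h1 : Polynomial.aeval x (Polynomial.derivative q) ≠ 0) : IsSeparable F x := by
  have hq : q ≠ 0 := by
    rintro rfl
    simp at h1
  have hx : IsIntegral F x := IsAlgebraic.isIntegral ⟨q, hq, h0⟩
  refine (Polynomial.separable_iff_derivative_ne_zero (minpoly.irreducible hx)).2 fun h => h1 ?_
  obtain ⟨r, hr⟩ := minpoly.dvd F x h0
  rw [hr, Polynomial.derivative_mul, map_add, map_mul, map_mul, minpoly.aeval, h]
  simp

/-- Over a finite field `k` every algebraic element is separable; otherwise `k` itself is infinite. -/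
theorem infinite_setOf_isSeparable (k Ω : Type*) [Field k] [Field Ω] [Algebra k Ω]
    [IsAlgClosed Ω] : {a : Ω | IsSeparable k a}.Infinite := by
  rcases finite_or_infinite k with hk | hk
  · have : IsAlgClosed (algebraicClosure k Ω) :=
      (algebraicClosure.isAlgClosure k Ω).isAlgClosed
    have h1 : ((algebraicClosure k Ω : IntermediateField k Ω) : Set Ω).Infinite :=
      Set.infinite_coe_iff.1 (inferInstanceAs (Infinite (algebraicClosure k Ω)))
    refine h1.mono fun a ha => ?_
    have ha : IsAlgebraic k a := mem_algebraicClosure_iff.1 ha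
    exact PerfectField.separable_of_irreducible (minpoly.irreducible ha.isIntegral)
  · refine (Set.infinite_range_of_injective (algebraMap k Ω).injective).mono ?_
    rintro _ ⟨a, rfl⟩
    exact isSeparable_algebraMap a

theorem MvPolynomial.exists_aeval_ne_zero_of_infinite {σ K Ω : Type*} [Field K] [Field Ω]
    [Algebra K Ω] {g : MvPolynomial σ K} (hg : g ≠ 0) {s : Set Ω} (hs : s.Infinite) :
    ∃ a : σ → Ω, (∀ i, a i ∈ s) ∧ MvPolynomial.aeval a g ≠ 0 := by
  by_contra! h
  refine hg (MvPolynomial.map_injective _ (algebraMap K Ω).injective ?_)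
  rw [map_zero]
  refine MvPolynomial.funext_set (fun _ => s) (fun _ => hs) fun x hx => ?_
  rw [MvPolynomial.eval_map, map_zero]
  exact h x fun i => hx i (Set.mem_univ i)

/-- An element `f` that is algebraic over `k(X)` is a root of a nonzero polynomial with coefficients
in `k[X]`, and a simple root if `f` is separable over `k(X)`. -/
theorem IntermediateField.exists_polynomial_algebra_adjoin {k V : Type*} [Field k] [Field V]
    [Algebra k V] {X : Set V} {f : V} (hf : IsAlgebraic (adjoin k X) f) :
    ∃ p : Polynomial (Algebra.adjoin k X), p ≠ 0 ∧ Polynomial.aeval f p = 0 ∧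
      (IsSeparable (adjoin k X) f → Polynomial.aeval f (Polynomial.derivative p) ≠ 0) := by
  open scoped algebraAdjoinAdjoin in
  let q := minpoly (adjoin k X) f
  let M := nonZeroDivisors (Algebra.adjoin k X)
  let p := IsLocalization.integerNormalization M q
  obtain ⟨b, hb, hp⟩ := IsLocalization.integerNormalization_spec M q
  have hb0 : algebraMap (Algebra.adjoin k X) (adjoin k X) b ≠ 0 := fun h =>
    nonZeroDivisors.ne_zero hb (FaithfulSMul.algebraMap_injective _ _ (h.trans (map_zero _).symm))
  have hp' : p.map (algebraMap (Algebra.adjoin k X) (adjoin k X)) =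
      Polynomial.C (algebraMap (Algebra.adjoin k X) (adjoin k X) b) * q := by
    rw [hp, ← algebraMap_smul (adjoin k X) b q, Polynomial.smul_eq_C_mul]
  refine ⟨p, ?_, ?_, ?_⟩
  · intro h
    rw [h, Polynomial.map_zero] at hp'
    exact (mul_ne_zero (Polynomial.C_ne_zero.2 hb0) (minpoly.ne_zero hf.isIntegral)) hp'.symm
  · rw [← Polynomial.aeval_map_algebraMap (adjoin k X), hp', map_mul, minpoly.aeval, mul_zero]
  · intro hsep
    rw [← Polynomial.aeval_map_algebraMap (adjoin k X), ← Polynomial.derivative_map, hp',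
      Polynomial.derivative_C_mul, map_mul, Polynomial.aeval_C]
    refine mul_ne_zero ((map_ne_zero _).2 hb0) ?_
    exact Polynomial.Separable.aeval_derivative_ne_zero hsep (minpoly.aeval _ _)

/-- Let `X` be algebraically independent over `K` in a field `V`, and let `F ⊆ V` be finite and
algebraic over `K(X)`. Then some `K`-homomorphism `φ` to an algebraic closure of `K` is defined at
`X`, at `F` and at the inverses of `F`, and takes values on `X` that are separable over a given
subfield `k` of `K`. It preserves separability of the members of `F`. -/
theorem exists_specialization {k K V : Type*} [Field k] [Field K] [Field V] [Algebra k K]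
    [Algebra K V] {X : Set V} (hX : AlgebraicIndepOn K id X)
    {F : Set V} (hF : F.Finite) (halg : ∀ f ∈ F, IsAlgebraic (adjoin K X) f) :
    ∃ (S : Subalgebra K V) (φ : S →ₐ[K] AlgebraicClosure K), X ⊆ S ∧ F ⊆ S ∧
      (∀ f ∈ F, f⁻¹ ∈ S) ∧ (∀ x : S, (x : V) ∈ X → IsSeparable k (φ x)) ∧
      ∀ x : S, (x : V) ∈ F → IsSeparable (adjoin K X) (x : V) → IsSeparable K (φ x) := by
  classical
  let Ω := AlgebraicClosure K
  let A := Algebra.adjoin K X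
  have hp : ∀ f : V, ∃ p : Polynomial A, IsAlgebraic (adjoin K X) f → p ≠ 0 ∧
      Polynomial.aeval f p = 0 ∧
      (IsSeparable (adjoin K X) f → Polynomial.aeval f (Polynomial.derivative p) ≠ 0) := by
    intro f
    by_cases hf : IsAlgebraic (adjoin K X) f
    · obtain ⟨p, hp⟩ := exists_polynomial_algebra_adjoin hf
      exact ⟨p, fun _ => hp⟩
    · exact ⟨0, fun h => (hf h).elim⟩
  choose p hp using hp
  -- The inverse of the derivative at a simple root forces the specialized root to be simple.
  let w : V → V := fun f => (Polynomial.aeval f (Polynomial.derivative (p f)))⁻¹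
  let F' : Set V := F ∪ ((fun f => f⁻¹) '' F ∪ w '' F)
  have hF' : F'.Finite := hF.union ((hF.image _).union (hF.image _))
  have halg' : ∀ f ∈ F', IsAlgebraic (adjoin K X) f := by
    rintro f (hf | ⟨f, hf, rfl⟩ | ⟨f, hf, rfl⟩)
    · exact halg f hf
    · exact (halg f hf).inv
    · refine IsAlgebraic.inv (mem_algebraicClosure_iff.1 ?_)
      rw [Polynomial.aeval_eq_sum_range]
      refine sum_mem fun i _ => ?_
      rw [Algebra.smul_def]
      refine mul_mem ?_ (pow_mem (mem_algebraicClosure_iff.2 (halg f hf)) i)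
      exact (algebraicClosure (adjoin K X) V).algebraMap_mem
        ⟨_, algebra_adjoin_le_adjoin K X ((Polynomial.derivative (p f)).coeff i).2⟩
  let G : A := ∏ f ∈ hF'.toFinset, (p f).leadingCoeff
  have hG : G ≠ 0 := Finset.prod_ne_zero_iff.2 fun f hf =>
    Polynomial.leadingCoeff_ne_zero.2 (hp f (halg' f (hF'.mem_toFinset.1 hf))).1
  have hX' : AlgebraicIndependent K ((↑) : X → V) := hX
  let ε : MvPolynomial X K ≃ₐ[K] A :=
    hX'.aevalEquiv.trans (Subalgebra.equivOfEq _ _ (by rw [Subtype.range_coe]))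
  have hε : ∀ x : X, ε (MvPolynomial.X x) = ⟨x, Algebra.subset_adjoin x.2⟩ := by
    intro x
    apply Subtype.ext
    change ((hX'.aevalEquiv (MvPolynomial.X x) : Algebra.adjoin K _) : V) = x
    rw [AlgebraicIndependent.aevalEquiv_apply_coe, MvPolynomial.aeval_X]
  obtain ⟨a, ha, hga⟩ := MvPolynomial.exists_aeval_ne_zero_of_infinite (Ω := Ω)
    (g := ε.symm G) ((map_ne_zero_iff _ ε.symm.injective).2 hG) (infinite_setOf_isSeparable k Ω)
  let φ₀ : A →ₐ[K] Ω := (MvPolynomial.aeval a).comp ε.symm.toAlgHom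
  have hφ₀ : ∀ f ∈ F', φ₀ (p f).leadingCoeff ≠ 0 := by
    intro f hf h
    refine hga ?_
    change φ₀ G = 0
    rw [map_prod]
    exact Finset.prod_eq_zero (hF'.mem_toFinset.2 hf) h
  obtain ⟨S₀, φ', hφ', hS₀⟩ := exists_ringHom_extension (E := V) φ₀.toRingHom
  let S : Subalgebra K V := S₀.restrictScalars K
  have hφA : ∀ c : A, φ' (algebraMap A S₀ c) = φ₀ c := fun c => RingHom.congr_fun hφ' c
  let φ : S →ₐ[K] Ω :=
    { toRingHom := φ'
      commutes' := fun c => (hφA (algebraMap K A c)).trans (φ₀.commutes c) }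
  have hFS : ∀ f ∈ F', f ∈ S := fun f hf => hS₀ f (p f) (hp f (halg' f hf)).2.1 (hφ₀ f hf)
  have hXS : ∀ (x : S) (hx : (x : V) ∈ X), φ x = a ⟨x, hx⟩ := by
    intro x hx
    have h1 : φ x = φ₀ ⟨x, Algebra.subset_adjoin hx⟩ := by
      rw [← hφA]; rfl
    rw [h1, ← hε ⟨x, hx⟩]
    change MvPolynomial.aeval a (ε.symm (ε _)) = _
    rw [AlgEquiv.symm_apply_apply, MvPolynomial.aeval_X]
  refine ⟨S, φ, fun x hx => S₀.algebraMap_mem ⟨x, Algebra.subset_adjoin hx⟩,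
    fun f hf => hFS f (Or.inl hf), fun f hf => hFS _ (Or.inr (Or.inl ⟨f, hf, rfl⟩)), ?_, ?_⟩
  · intro x hx
    rw [hXS x hx]
    exact ha _
  · intro x hx hsep
    let N := adjoin K (Set.range a)
    have hN : ∀ c : A, φ₀ c ∈ N := by
      intro c
      change MvPolynomial.aeval a (ε.symm c) ∈ N
      refine MvPolynomial.induction_on (motive := fun q => MvPolynomial.aeval a q ∈ N) _ ?_ ?_ ?_
      · intro c; rw [MvPolynomial.aeval_C]; exact N.algebraMap_mem c
      · intro q r hq hr; rw [map_add]; exact add_mem hq hr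
      · intro q i hq
        rw [map_mul, MvPolynomial.aeval_X]
        exact mul_mem hq (subset_adjoin K _ (Set.mem_range_self i))
    let χ : A →+* N := φ₀.toRingHom.codRestrict N hN
    let x₀ : S₀ := x
    have key : ∀ q : Polynomial A,
        Polynomial.aeval (φ x) (q.map χ) = φ' (Polynomial.aeval x₀ q) := by
      intro q
      exact (Polynomial.map_aeval_eq_aeval_map (φ := χ) (ψ := φ')
        (RingHom.ext fun c => (hφA c).symm) q x₀).symm
    have hcoe : ∀ q : Polynomial A,
        ((Polynomial.aeval x₀ q : S₀) : V) = Polynomial.aeval (x : V) q :=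
      fun q => (Polynomial.aeval_algebraMap_apply V x₀ q).symm
    have hpx := hp x (halg x hx)
    have hsepN : IsSeparable N (φ x) := by
      refine isSeparable_of_aeval_derivative_ne_zero (q := (p x).map χ) ?_ ?_
      · rw [key, show Polynomial.aeval x₀ (p x) = 0 from Subtype.ext ((hcoe _).trans hpx.2.1),
          map_zero]
      · rw [Polynomial.derivative_map, key]
        have hw : w x ∈ S₀ := hFS _ (Or.inr (Or.inr ⟨x, hx, rfl⟩))
        have h1 : Polynomial.aeval x₀ (Polynomial.derivative (p x)) * ⟨w x, hw⟩ = 1 :=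
          Subtype.ext (by
            rw [MulMemClass.coe_mul, hcoe]
            exact mul_inv_cancel₀ (hpx.2.2 hsep))
        intro h0
        have := congrArg φ' h1
        rw [map_mul, h0, zero_mul, map_one] at this
        exact zero_ne_one this
    have hNsep : Algebra.IsSeparable K N := (isSeparable_adjoin_iff_isSeparable K Ω).2 (by
      rintro _ ⟨i, rfl⟩
      exact IsSeparable.tower_top K (ha i))
    exact IsSeparable.of_algebra_isSeparable_of_isSeparable K hsepN

/-! ### Images under a partially defined homomorphism

For a homomorphism `φ` defined on a subalgebra `S` of a field `V` and a set `T ⊆ S`, the set of values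
of `φ` on `T` is `φ '' (Subtype.val ⁻¹' T)`. -/

section Image

variable {k K V Ω : Type*} [Field k] [Field K] [Field V] [Field Ω] [Algebra k K] [Algebra K V]
  [Algebra k V] [IsScalarTower k K V] [Algebra K Ω] [Algebra k Ω] [IsScalarTower k K Ω]
  {S : Subalgebra K V} (φ : S →ₐ[K] Ω) {T : Set V}

theorem map_mem_algebra_adjoin (hT : T ⊆ S) {x : S} (hx : (x : V) ∈ Algebra.adjoin k T) :
    φ x ∈ Algebra.adjoin k (φ '' (Subtype.val ⁻¹' T)) := by
  have h1 : (Algebra.adjoin k (Subtype.val ⁻¹' T : Set S)).map (S.val.restrictScalars k) =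
      Algebra.adjoin k T := by
    rw [AlgHom.map_adjoin]
    congr 1
    exact Subtype.image_preimage_coe _ _ |>.trans (Set.inter_eq_right.2 hT)
  rw [← h1] at hx
  obtain ⟨y, hy, hyx⟩ := hx
  obtain rfl : y = x := Subtype.ext hyx
  have h2 : (Algebra.adjoin k (Subtype.val ⁻¹' T : Set S)).map (φ.restrictScalars k) =
      Algebra.adjoin k (φ '' (Subtype.val ⁻¹' T)) := AlgHom.map_adjoin _ _
  rw [← h2]
  exact ⟨y, hy, rfl⟩

theorem map_mem_adjoin_of_eq_div (hT : T ⊆ S) {x : S} {p h : V} (hp : p ∈ Algebra.adjoin k T)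
    (hh : h ∈ Algebra.adjoin k T) (hinv : h⁻¹ ∈ S) (hx : (x : V) = p / h) :
    φ x ∈ adjoin k (φ '' (Subtype.val ⁻¹' T)) := by
  have hTS : Algebra.adjoin k T ≤ S.restrictScalars k := Algebra.adjoin_le hT
  by_cases h0 : h = 0
  · have : x = 0 := Subtype.ext (by rw [hx, h0, div_zero]; rfl)
    rw [this, map_zero]
    exact zero_mem _
  · let p' : S := ⟨p, hTS hp⟩
    let h' : S := ⟨h, hTS hh⟩
    have h1 : x * h' = p' := Subtype.ext (by
      rw [MulMemClass.coe_mul, hx]; exact div_mul_cancel₀ p h0)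
    have h2 : h' * ⟨h⁻¹, hinv⟩ = 1 := Subtype.ext (mul_inv_cancel₀ h0)
    have h3 : φ h' ≠ 0 := fun h3 => by
      have := congrArg φ h2
      rw [map_mul, h3, zero_mul, map_one] at this
      exact zero_ne_one this
    have h4 : φ x = φ p' / φ h' := by
      rw [eq_div_iff h3, ← map_mul, h1]
    rw [h4]
    exact div_mem (algebra_adjoin_le_adjoin k _ (map_mem_algebra_adjoin φ hT hp))
      (algebra_adjoin_le_adjoin k _ (map_mem_algebra_adjoin φ hT hh))

theorem isAlgebraic_map_of_inv_leadingCoeff_mem (hT : T ⊆ S) {x : S}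
    {q : Polynomial (Algebra.adjoin k T)} (hq : q ≠ 0) (hqx : Polynomial.aeval (x : V) q = 0)
    (hinv : (q.leadingCoeff : V)⁻¹ ∈ S) :
    IsAlgebraic (adjoin k (φ '' (Subtype.val ⁻¹' T))) (φ x) := by
  have hTS : Algebra.adjoin k T ≤ S.restrictScalars k := Algebra.adjoin_le hT
  let N := adjoin k (φ '' (Subtype.val ⁻¹' T))
  let i : Algebra.adjoin k T →+* S := (Subalgebra.inclusion hTS).toRingHom
  let χ : Algebra.adjoin k T →+* N := (φ.toRingHom.comp i).codRestrict N fun c =>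
    algebra_adjoin_le_adjoin k _ (map_mem_algebra_adjoin φ hT (x := i c) c.2)
  refine ⟨q.map χ, fun h => ?_, ?_⟩
  · have h1 : χ q.leadingCoeff = 0 := by
      rw [Polynomial.leadingCoeff, ← Polynomial.coeff_map, h, Polynomial.coeff_zero]
    have h2 : φ (i q.leadingCoeff) = 0 := congrArg Subtype.val h1
    have h3 : i q.leadingCoeff * ⟨_, hinv⟩ = 1 := Subtype.ext (mul_inv_cancel₀ fun h0 =>
      hq (Polynomial.leadingCoeff_eq_zero.1 (Subtype.ext h0)))
    have := congrArg φ h3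
    rw [map_mul, h2, zero_mul, map_one] at this
    exact zero_ne_one this
  · have h1 : Polynomial.eval₂ i x q = 0 := by
      apply Subtype.val_injective
      change S.val.toRingHom _ = _
      rw [Polynomial.hom_eval₂]
      exact hqx
    rw [Polynomial.aeval_def, Polynomial.eval₂_map]
    have h2 := congrArg φ.toRingHom h1
    rw [Polynomial.hom_eval₂, map_zero] at h2
    exact h2

end Image

/-! ### Specializing a covering diagram -/

theorem exists_finset_forall_of_mono {α β : Type*} {L : Set β} {W : Set α} (hW : W.Finite)
    {P : α → Set β → Prop} (hP : ∀ x, Monotone (P x))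
    (h : ∀ x ∈ W, ∃ T : Finset β, (T : Set β) ⊆ L ∧ P x T) :
    ∃ T : Finset β, (T : Set β) ⊆ L ∧ ∀ x ∈ W, P x T := by
  classical
  induction W, hW using Set.Finite.induction_on with
  | empty => exact ⟨∅, by simp, by simp⟩
  | @insert w W _ _ ih =>
    obtain ⟨T, hT, hTW⟩ := ih fun x hx => h x (Set.mem_insert_of_mem _ hx)
    obtain ⟨T', hT', hw⟩ := h w (Set.mem_insert _ _)
    refine ⟨T ∪ T', by simp [hT, hT'], ?_⟩
    rintro x (rfl | hx)
    · exact hP _ (by simp) hw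
    · exact hP _ (by simp) (hTW x hx)

/-- Let `V` contain `K` together with the ingredients of a covering diagram over an extension `L` of
`k`: a set `B` and an element `t`, and a family `e` whose span over `k(B, t)` is a ring containing
`K`. Suppose that `B` is algebraic over `L(z)` for a set `z` with fewer elements than a transcendence
basis of `K/k`, and that every finite part of `L` is algebraic over `k(X)` for some set `X`
algebraically independent over `K`. Then `K/k` has a covering diagram of degree at most the
cardinality of `e`, namely the image of the given one under a general specialization of `X` to
elements algebraic over `k`. -/
theorem exists_coveringDiagram_of_specialization {k : Type u} {K : Type v} {V : Type*}
    [Field k] [Field K] [Field V] [Algebra k K] [Algebra K V] [Algebra k V] [IsScalarTower k K V]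
    [Algebra.EssFiniteType k K] (sep : Prop) {L B z : Set V} {t : V} {ι : Type*} [Fintype ι]
    (e : ι → V) (hz : z.Finite) {s : Set K} (hs : AlgebraicIndepOn k id s)
    (hzs : z.encard + 1 ≤ s.encard)
    (halg : ∀ x ∈ insert t (B ∪ z ∪ Set.range e), IsAlgebraic (adjoin K L) x)
    (hsep : sep → ∀ x ∈ insert t (B ∪ z ∪ Set.range e), IsSeparable (adjoin K L) x)
    (hB : ∀ b ∈ B, IsAlgebraic (adjoin k (L ∪ z)) b)
    (h1 : (1 : V) ∈ Submodule.span (adjoin k (B ∪ {t})) (Set.range e))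
    (hmul : ∀ i j, e i * e j ∈ Submodule.span (adjoin k (B ∪ {t})) (Set.range e))
    (hK : ∀ x : K, algebraMap K V x ∈ Submodule.span (adjoin k (B ∪ {t})) (Set.range e))
    (hL : ∀ l : Finset V, (l : Set V) ⊆ L → ∃ X : Set V, AlgebraicIndepOn K id X ∧
      (∀ x ∈ l, IsAlgebraic (adjoin k X) x) ∧ (sep → ∀ x ∈ l, IsSeparable (adjoin K X) x)) :
    ∃ D : CoveringDiagram k K, D.degree ≤ Fintype.card ι ∧ (sep → D.IsSeparable) := by
  classical
  obtain ⟨y, hy⟩ := fg_top k K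
  -- The finitely many coefficients `C` expressing the given data in terms of `e`.
  simp only [Submodule.mem_span_range_iff_exists_fun] at h1 hmul hK
  obtain ⟨c₁, hc₁⟩ := h1
  choose cm hcm using hmul
  choose cy hcy using hK
  let C : Set V := Set.range (fun i => (c₁ i : V)) ∪
    (Set.range (fun i : ι × ι × ι => (cm i.1 i.2.1 i.2.2 : V)) ∪
      Set.range (fun i : y × ι => (cy i.1 i.2 : V)))
  have hCfin : C.Finite :=
    (Set.finite_range _).union ((Set.finite_range _).union (Set.finite_range _))
  have hCB : C ⊆ adjoin k (B ∪ {t}) := by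
    rintro _ (⟨i, rfl⟩ | ⟨i, rfl⟩ | ⟨i, rfl⟩) <;> exact Subtype.property _
  obtain ⟨T, hTB, hCT⟩ := exists_finset_subset_adjoin hCfin hCB
  let b : Set V := {x | x ∈ T ∧ x ∈ B}
  have hb : b.Finite := T.finite_toSet.subset fun x hx => hx.1
  have hTb : (T : Set V) ⊆ b ∪ {t} := fun x hx =>
    (hTB hx).imp (fun h => ⟨hx, h⟩) fun h => h
  have hC : ∀ c ∈ C, ∃ p ∈ Algebra.adjoin k (b ∪ {t}), ∃ h ∈ Algebra.adjoin k (b ∪ {t}),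
      c = p / h := fun c hc => mem_adjoin_iff_div.1 (adjoin.mono k _ _ hTb (hCT hc))
  choose! p hp h hh hph using hC
  -- A finite part `l` of `L` over which all of the data is defined.
  let W : Set V := insert t (b ∪ z ∪ Set.range e)
  have hWfin : W.Finite := ((hb.union hz).union (Set.finite_range e)).insert t
  have hWB : W ⊆ insert t (B ∪ z ∪ Set.range e) :=
    Set.insert_subset_insert (Set.union_subset_union_left _ (Set.union_subset_union_left _
      fun x hx => hx.2))
  obtain ⟨l₁, hl₁, hWl₁⟩ := exists_finset_forall_of_mono hWfin (L := L)
    (P := fun x T => IsAlgebraic (adjoin K T) x) (fun x S T hST h => isAlgebraic_adjoin_mono hST h)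
    fun x hx => exists_finset_isAlgebraic_adjoin (halg x (hWB hx))
  obtain ⟨l₂, hl₂, hWl₂⟩ := exists_finset_forall_of_mono hWfin (L := L)
    (P := fun x T => sep → IsSeparable (adjoin K T) x)
    (fun x S T hST h h' => isSeparable_adjoin_mono hST (h h')) (by
      intro x hx
      by_cases hse : sep
      · obtain ⟨T, hT, hTx⟩ := exists_finset_isSeparable_adjoin (hsep hse x (hWB hx))
        exact ⟨T, hT, fun _ => hTx⟩
      · exact ⟨∅, by simp, fun h => (hse h).elim⟩)
  obtain ⟨l₃, hl₃, hbl₃⟩ := exists_finset_forall_of_mono hb (L := L)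
    (P := fun x T => IsAlgebraic (adjoin k (T ∪ z)) x)
    (fun x S T hST h => isAlgebraic_adjoin_mono (Set.union_subset_union_left _ hST) h) (by
      intro x hx
      obtain ⟨T, hT, hTx⟩ := exists_finset_isAlgebraic_adjoin (hB x hx.2)
      refine ⟨T.filter (· ∈ L), fun y hy => (Finset.mem_filter.1 hy).2,
        isAlgebraic_adjoin_mono (fun y hy => ?_) hTx⟩
      rcases hT hy with h | h
      · exact Or.inl (by simpa using ⟨hy, h⟩)
      · exact Or.inr h)
  obtain ⟨X, hX, hlX, hlXs⟩ := hL (l₁ ∪ (l₂ ∪ l₃)) (by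
    rw [Finset.coe_union, Finset.coe_union]
    exact Set.union_subset hl₁ (Set.union_subset hl₂ hl₃))
  have hkK : ∀ a : adjoin k X, algebraMap (adjoin k X) V a ∈ adjoin K X := fun a =>
    (adjoin_le_iff.2 (subset_adjoin K X) : adjoin k X ≤ (adjoin K X).restrictScalars k) a.2
  have hWX : ∀ x ∈ W, IsAlgebraic (adjoin K X) x := fun x hx =>
    isAlgebraic_of_isAlgebraic_adjoin (N := adjoin K X) (fun y hy =>
      isAlgebraic_of_algebraMap_mem (A := adjoin k X) (adjoin K X) hkK
        (hlX y (Finset.mem_union_left _ hy))) (hWl₁ x hx)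
  have hWXs : sep → ∀ x ∈ W, IsSeparable (adjoin K X) x := fun hse x hx =>
    isSeparable_of_isSeparable_adjoin (N := adjoin K X) (fun y hy =>
      hlXs hse y (Finset.mem_union_right _ (Finset.mem_union_left _ hy))) (hWl₂ x hx hse)
  have hbX : ∀ x ∈ b, IsAlgebraic (adjoin k (X ∪ z)) x := by
    intro x hx
    refine isAlgebraic_of_isAlgebraic_adjoin (N := adjoin k (X ∪ z)) ?_ (hbl₃ x hx)
    rintro y (hy | hy)
    · exact isAlgebraic_adjoin_mono Set.subset_union_left
        (hlX y (Finset.mem_union_right _ (Finset.mem_union_right _ hy)))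
    · exact isAlgebraic_algebraMap
        (⟨y, subset_adjoin k _ (Or.inr hy)⟩ : adjoin k (X ∪ z))
  have hq : ∀ x ∈ b, ∃ q : Polynomial (Algebra.adjoin k (X ∪ z)), q ≠ 0 ∧
      Polynomial.aeval x q = 0 := fun x hx => by
    obtain ⟨q, hq⟩ := exists_polynomial_algebra_adjoin (hbX x hx)
    exact ⟨q, hq.1, hq.2.1⟩
  choose! q hq0 hqx using hq
  -- The specialization is required to be finite at `F` and at the inverses of `F`.
  let F : Set V := W ∪ (C ∪ (h '' C ∪ (fun x => ((q x).leadingCoeff : V)) '' b))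
  have hFfin : F.Finite := hWfin.union (hCfin.union ((hCfin.image _).union (hb.image _)))
  have : IsScalarTower k (adjoin K X) V :=
    IsScalarTower.to₁₃₄ k K (adjoin K X) V
  have hbt : ∀ x ∈ adjoin k (b ∪ {t}), IsAlgebraic (adjoin K X) x := fun x hx =>
    isAlgebraic_of_mem_adjoin (by
      rintro y (hy | rfl)
      · exact hWX y (Or.inr (Or.inl (Or.inl hy)))
      · exact hWX y (Or.inl rfl)) hx
  have hFX : ∀ f ∈ F, IsAlgebraic (adjoin K X) f := by
    rintro f (hf | hf | ⟨c, hc, rfl⟩ | ⟨x, hx, rfl⟩)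
    · exact hWX f hf
    · exact hbt f (adjoin.mono k _ _ hTb (hCT hf))
    · exact hbt _ (algebra_adjoin_le_adjoin k _ (hh c hc))
    · refine isAlgebraic_of_mem_adjoin (k := k) (S := X ∪ z) ?_
        (algebra_adjoin_le_adjoin k _ ((q x).leadingCoeff).2)
      rintro y (hy | hy)
      · exact isAlgebraic_algebraMap (⟨y, subset_adjoin K X hy⟩ : adjoin K X)
      · exact hWX y (Or.inr (Or.inl (Or.inr hy)))
  obtain ⟨S, φ, hXS, hFS, hFinv, hφX, hφF⟩ := exists_specialization (k := k) hX hFfin hFX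
  let Ω := AlgebraicClosure K
  have hWS : W ⊆ S := fun x hx => hFS (Or.inl hx)
  have hbS : b ⊆ S := fun x hx => hWS (Or.inr (Or.inl (Or.inl hx)))
  have hzS : z ⊆ S := fun x hx => hWS (Or.inr (Or.inl (Or.inr hx)))
  have htS : t ∈ S := hWS (Or.inl rfl)
  have heS : ∀ i, e i ∈ S := fun i => hWS (Or.inr (Or.inr (Set.mem_range_self i)))
  let b' : Set Ω := φ '' (Subtype.val ⁻¹' b)
  let B' : IntermediateField k Ω := adjoin k b'
  let t' : Ω := φ ⟨t, htS⟩
  let e' : ι → Ω := fun i => φ ⟨e i, heS i⟩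
  let N := B'⟮t'⟯
  have hbN : ∀ x ∈ B', x ∈ N := fun x hx => N.algebraMap_mem ⟨x, hx⟩
  have htN : t' ∈ N := mem_adjoin_simple_self _ _
  have hCN : ∀ c (hc : c ∈ C), φ ⟨c, hFS (Or.inr (Or.inl hc))⟩ ∈ N := by
    intro c hc
    have h2 := map_mem_adjoin_of_eq_div φ (Set.union_subset hbS (Set.singleton_subset_iff.2 htS))
      (x := ⟨c, hFS (Or.inr (Or.inl hc))⟩) (hp c hc) (hh c hc)
      (hFinv _ (Or.inr (Or.inr (Or.inl ⟨c, hc, rfl⟩)))) (hph c hc)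
    have h3 : adjoin k (φ '' (Subtype.val ⁻¹' (b ∪ {t}))) ≤ N.restrictScalars k := by
      refine adjoin_le_iff.2 ?_
      rintro _ ⟨x, hx | hx, rfl⟩
      · exact hbN _ (subset_adjoin k _ ⟨x, hx, rfl⟩)
      · have : x = ⟨t, htS⟩ := Subtype.ext hx
        rw [this]
        exact htN
    exact h3 h2
  have hspan : ∀ (x : S) (c : ι → adjoin k (B ∪ {t})), (∀ i, (c i : V) ∈ C) →
      ∑ i, c i • e i = (x : V) → φ x ∈ Submodule.span N (Set.range e') := by
    intro x c hc hx
    have h2 : x = ∑ i, (⟨c i, hFS (Or.inr (Or.inl (hc i)))⟩ : S) * ⟨e i, heS i⟩ := by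
      apply Subtype.ext
      rw [← hx, AddSubmonoidClass.coe_finsetSum]
      exact Finset.sum_congr rfl fun i _ => Algebra.smul_def _ _
    rw [h2, map_sum]
    refine Submodule.sum_mem _ fun i _ => ?_
    rw [map_mul]
    exact Submodule.smul_mem _ (⟨_, hCN _ (hc i)⟩ : N)
      (Submodule.subset_span (Set.mem_range_self i))
  obtain ⟨E, hEalg, hE⟩ := exists_intermediateField_eq_span (F := N) e'
    (by
      have := hspan 1 c₁ (fun i => Or.inl ⟨i, rfl⟩) hc₁
      rwa [map_one] at this)
    (fun i j => by
      have := hspan (⟨e i, heS i⟩ * ⟨e j, heS j⟩) (cm i j)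
        (fun m => Or.inr (Or.inl ⟨(i, j, m), rfl⟩)) (hcm i j)
      rwa [map_mul] at this)
  have hNE : ∀ x ∈ N, x ∈ E := fun x hx => E.algebraMap_mem ⟨x, hx⟩
  have hKE : ∀ x : K, algebraMap K Ω x ∈ E := by
    intro x
    have hx : x ∈ adjoin k (y : Set K) := hy ▸ mem_top
    induction hx using adjoin_induction with
    | mem x hx =>
      refine (hE _).2 ?_
      have := hspan (algebraMap K S x) (cy x)
        (fun i => Or.inr (Or.inr ⟨(⟨x, hx⟩, i), rfl⟩)) (hcy x)
      rwa [φ.commutes] at this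
    | algebraMap c =>
      rw [← IsScalarTower.algebraMap_apply k K Ω]
      exact hNE _ (hbN _ (B'.algebraMap_mem c))
    | add x y _ _ hx hy => rw [map_add]; exact add_mem hx hy
    | inv x _ hx => rw [map_inv₀]; exact inv_mem hx
    | mul x y _ _ hx hy => rw [map_mul]; exact mul_mem hx hy
  let W' : Set V := insert t (b ∪ Set.range e)
  have hW'W : W' ⊆ W := Set.insert_subset_insert
    (Set.union_subset_union_left _ Set.subset_union_left)
  have hW'fin : W'.Finite := hWfin.subset hW'W
  let w : Set Ω := φ '' (Subtype.val ⁻¹' W')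
  have hwfin : w.Finite := (hW'fin.preimage Subtype.val_injective.injOn).image _
  let KC : IntermediateField K Ω := adjoin K w
  have hKCfin : FiniteDimensional K KC := by
    have := hwfin.to_subtype
    exact finiteDimensional_adjoin fun x _ => Algebra.IsIntegral.isIntegral x
  have hKCE : ∀ x ∈ KC, x ∈ E := by
    intro x hx
    induction hx using adjoin_induction with
    | mem x hx =>
      obtain ⟨v, hv | hv | ⟨i, hi⟩, rfl⟩ := hx
      · have : v = ⟨t, htS⟩ := Subtype.ext hv
        rw [this]
        exact hNE _ htN
      · exact hNE _ (hbN _ (subset_adjoin k _ ⟨v, hv, rfl⟩))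
      · have : v = ⟨e i, heS i⟩ := Subtype.ext hi.symm
        rw [this]
        exact (hE _).2 (Submodule.subset_span (Set.mem_range_self i))
    | algebraMap x => exact hKE x
    | add x y _ _ hx hy => exact add_mem hx hy
    | inv x _ hx => exact inv_mem hx
    | mul x y _ _ hx hy => exact mul_mem hx hy
  obtain ⟨D, hD, hDs⟩ := CoveringDiagram.exists_degree_le (k := k) KC B'
    (by
      have : B' ≤ KC.restrictScalars k := by
        refine adjoin_le_iff.2 ?_
        rintro _ ⟨v, hv, rfl⟩
        exact subset_adjoin K _ ⟨v, Or.inr (Or.inl hv), rfl⟩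
      exact this)
    (t := t') (subset_adjoin K _ ⟨⟨t, htS⟩, Or.inl rfl, rfl⟩)
    (by
      intro ht
      -- Otherwise `K` would be algebraic over the specialization of `k(z)`.
      let z' : Set Ω := φ '' (Subtype.val ⁻¹' z)
      have hzz : z'.encard ≤ z.encard := by
        refine (Set.encard_image_le _ _).trans ?_
        rw [← Subtype.val_injective.encard_image]
        exact Set.encard_le_encard (Set.image_preimage_subset _ _)
      have hb' : ∀ x ∈ b', IsAlgebraic (adjoin k z') x := by
        rintro _ ⟨v, hv, rfl⟩
        have h2 := isAlgebraic_map_of_inv_leadingCoeff_mem φ (Set.union_subset hXS hzS)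
          (hq0 v hv) (hqx v hv)
          (hFinv _ (Or.inr (Or.inr (Or.inr ⟨v, hv, rfl⟩))))
        refine isAlgebraic_of_isAlgebraic_adjoin (N := adjoin k z') ?_ h2
        rintro _ ⟨u, hu | hu, rfl⟩
        · exact (hφX u hu).isIntegral.isAlgebraic.tower_top _
        · exact isAlgebraic_algebraMap (⟨φ u, subset_adjoin k _ ⟨u, hu, rfl⟩⟩ : adjoin k z')
      have hB' : ∀ x ∈ B', IsAlgebraic (adjoin k z') x := fun x hx =>
        isAlgebraic_of_mem_adjoin hb' hx
      have ht' : IsAlgebraic (adjoin k z') t' := isAlgebraic_of_isAlgebraic_adjoin hb' ht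
      have hKz : ∀ x : K, IsAlgebraic (adjoin k z') (algebraMap K Ω x) := by
        intro x
        have h3 : IsAlgebraic N (algebraMap K Ω x) := hEalg _ (hKE x)
        have h4 : IsAlgebraic (adjoin k ((B' : Set Ω) ∪ {t'})) (algebraMap K Ω x) :=
          isAlgebraic_of_algebraMap_mem (A := N) _
            (fun a => mem_adjoin_union_of_mem_adjoin_simple B' a.2) h3
        refine isAlgebraic_of_isAlgebraic_adjoin (N := adjoin k z') ?_ h4
        rintro u (hu | rfl)
        · exact hB' u hu
        · exact ht'
      have h5 : (IsScalarTower.toAlgHom k K Ω '' s).encard ≤ z'.encard :=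
        encard_le_of_isAlgebraic_adjoin (hs.image_algHom _) (by
          rintro _ ⟨x, -, rfl⟩; exact hKz x)
      have h7 : Function.Injective (IsScalarTower.toAlgHom k K Ω) := RingHom.injective _
      rw [h7.encard_image] at h5
      have h6 := hzs.trans (h5.trans hzz)
      exact absurd h6 (not_le.2 ((ENat.lt_add_one_iff hz.encard_lt_top.ne).2 le_rfl)))
    e' fun x hx => (hE x).1 (hKCE x hx)
  refine ⟨D, hD, fun hse => hDs ?_⟩
  refine (isSeparable_adjoin_iff_isSeparable K Ω).2 ?_
  rintro _ ⟨v, hv, rfl⟩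
  exact hφF v (Or.inl (hW'W hv)) (hWXs hse v (hW'W hv))

/-! ### Algebraic independence in a field of a tensor product -/

/-- A field is flat over a polynomial ring generated by algebraically independent elements. -/
theorem AlgebraicIndependent.flat_aeval {k L ι : Type*} [Field k] [Field L] [Algebra k L]
    {x : ι → L} (hx : AlgebraicIndependent k x) :
    letI := (MvPolynomial.aeval (R := k) x).toAlgebra
    Module.Flat (MvPolynomial ι k) L := by
  let _ := (MvPolynomial.aeval (R := k) x).toAlgebra
  have : FaithfulSMul (MvPolynomial ι k) L := (faithfulSMul_iff_algebraMap_injective _ _).2 hx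
  let F := FractionRing (MvPolynomial ι k)
  let _ : Algebra F L := FractionRing.liftAlgebra _ _
  have : IsScalarTower (MvPolynomial ι k) F L := FractionRing.isScalarTower_liftAlgebra _ _
  have : Module.Flat (MvPolynomial ι k) F := IsLocalization.flat F (nonZeroDivisors _)
  exact Module.Flat.trans (MvPolynomial ι k) F L

/-- If `x` is algebraically independent over `k` in `L`, then a nonzero polynomial in `x` with
coefficients in `K` is not a zero divisor in `L ⊗[k] K`. -/
theorem AlgebraicIndependent.map_mem_nonZeroDivisors {k K L ι : Type*} [Field k] [Field K]
    [Field L] [Algebra k K] [Algebra k L] {x : ι → L} (hx : AlgebraicIndependent k x)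
    {a : MvPolynomial ι k ⊗[k] K} (ha : a ≠ 0) :
    Algebra.TensorProduct.map (MvPolynomial.aeval x) (AlgHom.id k K) a ∈
      nonZeroDivisors (L ⊗[k] K) := by
  let P := MvPolynomial ι k
  let _ : Algebra P L := (MvPolynomial.aeval (R := k) x).toAlgebra
  have : IsScalarTower k P L := IsScalarTower.of_algebraMap_eq fun c =>
    ((MvPolynomial.aeval x).commutes c).symm
  have : Module.Flat P L := hx.flat_aeval
  let ε : P ⊗[k] K ≃ₐ[k] MvPolynomial ι K := (Algebra.TensorProduct.comm k P K).trans
    ((MvPolynomial.algebraTensorAlgEquiv k K).restrictScalars k)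
  have : IsDomain (P ⊗[k] K) := ε.toMulEquiv.isDomain _
  let m : P ⊗[k] K →ₗ[P] P ⊗[k] K := LinearMap.mulLeft P a
  have hm : Function.Injective m := mul_right_injective₀ ha
  have hm' := Module.Flat.lTensor_preserves_injective_linearMap (M := L) m hm
  let c : L ⊗[P] (P ⊗[k] K) ≃ₗ[L] L ⊗[k] K :=
    TensorProduct.AlgebraTensorModule.cancelBaseChange k P L L K
  let f : P ⊗[k] K →ₐ[k] L ⊗[k] K :=
    Algebra.TensorProduct.map (MvPolynomial.aeval x) (AlgHom.id k K)
  have hc : ∀ (u : L) (v : P ⊗[k] K), c (u ⊗ₜ v) = (u ⊗ₜ 1) * f v := by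
    intro u v
    induction v using TensorProduct.induction_on with
    | zero => rw [TensorProduct.tmul_zero, map_zero, map_zero, mul_zero]
    | add v w hv hw => rw [TensorProduct.tmul_add, map_add, hv, hw, map_add, mul_add]
    | tmul q y =>
      change c (u ⊗ₜ (q ⊗ₜ y)) = (u ⊗ₜ 1) * (MvPolynomial.aeval x q ⊗ₜ y)
      rw [Algebra.TensorProduct.tmul_mul_tmul, one_mul, mul_comm]
      exact TensorProduct.AlgebraTensorModule.cancelBaseChange_tmul k P L u y q
  have key : ∀ w : L ⊗[P] (P ⊗[k] K), c (m.lTensor L w) = f a * c w := by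
    intro w
    induction w using TensorProduct.induction_on with
    | zero => simp only [map_zero, mul_zero]
    | add v w hv hw => rw [map_add, map_add, hv, hw, map_add, mul_add]
    | tmul u v =>
      rw [LinearMap.lTensor_tmul, hc, hc]
      change u ⊗ₜ 1 * f (a * v) = _
      rw [map_mul]
      ring
  rw [mem_nonZeroDivisors_iff_left]
  intro y hy
  obtain ⟨w, rfl⟩ := c.surjective y
  have h1 : m.lTensor L w = 0 := c.injective (by rw [key, map_zero]; exact hy)
  rw [(map_eq_zero_iff _ hm').1 h1, map_zero]

namespace IsFieldOfTensorProduct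

variable {k K L K' : Type*} [Field k] [Field K] [Field L] [Field K']
    [Algebra k K] [Algebra k L] [Algebra k K'] [Algebra K K'] [Algebra L K']
    [IsScalarTower k K K'] [IsScalarTower k L K']

theorem symm (h : IsFieldOfTensorProduct k K L K') : IsFieldOfTensorProduct k L K K' := by
  have hcomm : (Algebra.TensorProduct.productMap (IsScalarTower.toAlgHom k K K')
      (IsScalarTower.toAlgHom k L K')).comp (Algebra.TensorProduct.comm k L K).toAlgHom =
      Algebra.TensorProduct.productMap (IsScalarTower.toAlgHom k L K')
      (IsScalarTower.toAlgHom k K K') := by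
    ext <;> simp
  have hcomm' := fun x => AlgHom.congr_fun hcomm x
  constructor
  · let c : L ⊗[k] K →+* K ⊗[k] L := (Algebra.TensorProduct.comm k L K).toAlgHom.toRingHom
    have hc : Function.Bijective c := (Algebra.TensorProduct.comm k L K).bijective
    have h1 := Ideal.minimalPrimes_comap_of_surjective (f := c) hc.2 h.ker_mem_minimalPrimes
    have h2 : Ideal.comap c ⊥ = ⊥ := (RingHom.injective_iff_ker_eq_bot c).1 hc.1
    rw [h2] at h1
    rw [minimalPrimes, ← hcomm]
    exact h1
  · intro x
    obtain ⟨a, b, hab⟩ := h.exists_div_eq x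
    refine ⟨(Algebra.TensorProduct.comm k L K).symm a,
      (Algebra.TensorProduct.comm k L K).symm b, ?_⟩
    rw [← hcomm', ← hcomm', hab]
    simp

theorem algebraicIndependent_right (h : IsFieldOfTensorProduct k K L K') {ι : Type*} {x : ι → L}
    (hx : AlgebraicIndependent k x) :
    AlgebraicIndependent K (fun i => algebraMap L K' (x i)) := by
  rw [algebraicIndependent_iff]
  intro p hp
  by_contra hp0
  let ε : MvPolynomial ι k ⊗[k] K ≃ₐ[k] MvPolynomial ι K :=
    (Algebra.TensorProduct.comm k (MvPolynomial ι k) K).trans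
      ((MvPolynomial.algebraTensorAlgEquiv k K).restrictScalars k)
  have h1 := hx.map_mem_nonZeroDivisors (K := K) (a := ε.symm p)
    ((map_ne_zero_iff _ ε.symm.injective).2 hp0)
  refine Set.disjoint_left.1 (Ideal.disjoint_nonZeroDivisors_of_mem_minimalPrimes
    h.symm.ker_mem_minimalPrimes) ?_ h1
  rw [SetLike.mem_coe, RingHom.mem_ker]
  have key : ∀ q : MvPolynomial ι k ⊗[k] K,
      Algebra.TensorProduct.productMap (IsScalarTower.toAlgHom k L K')
        (IsScalarTower.toAlgHom k K K')
        (Algebra.TensorProduct.map (MvPolynomial.aeval x) (AlgHom.id k K) q) =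
      MvPolynomial.aeval (fun i => algebraMap L K' (x i)) (ε q) := by
    intro q
    let g₁ := (Algebra.TensorProduct.productMap (IsScalarTower.toAlgHom k L K')
        (IsScalarTower.toAlgHom k K K')).comp
        (Algebra.TensorProduct.map (MvPolynomial.aeval x) (AlgHom.id k K))
    let g₂ := ((MvPolynomial.aeval (R := K) (fun i => algebraMap L K' (x i))).restrictScalars
      k).comp ε.toAlgHom
    have : g₁ = g₂ := by
      ext i
      · simp [g₁, g₂, ε]
      · simp [g₁, g₂, ε, Algebra.smul_def]
    exact AlgHom.congr_fun this q
  refine (key _).trans ?_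
  rw [AlgEquiv.apply_symm_apply]
  exact hp

end IsFieldOfTensorProduct

theorem IsTranscendenceBasis.finite_of_essFiniteType {k K : Type*} [Field k]
    [Field K] [Algebra k K] [Algebra.EssFiniteType k K] {s : Set K}
    (hs : IsTranscendenceBasis k ((↑) : s → K)) : s.Finite := by
  have h1 := hs.cardinalMk_eq_trdeg
  have h2 : Algebra.trdeg k K < Cardinal.aleph0 := trdeg_lt_aleph0 k K
  rw [← h1] at h2
  exact Cardinal.lt_aleph0_iff_set_finite.1 h2

theorem exists_fin_finrank_spanning_family (F C : Type*) [Field F] [Field C] [Algebra F C]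
    [FiniteDimensional F C] : ∃ e : Fin (Module.finrank F C) → C,
      ∀ c, ∃ a : Fin (Module.finrank F C) → F, c = ∑ i, algebraMap F C (a i) * e i := by
  have : Module.Free F C := Module.Free.of_divisionRing F C
  let e := Module.finBasis F C
  refine ⟨e, fun c => ⟨e.repr c, ?_⟩⟩
  simp_rw [← Algebra.smul_def]
  exact (e.sum_repr c).symm

/-- A basis of `KC` over `KB(t)`, with coefficients regarded as elements of `KC`. -/
theorem CoveringDiagram.exists_spanning_family {k K : Type*} [Field k] [Field K] [Algebra k K]
    (D : CoveringDiagram k K) : ∃ e : Fin D.degree → D.KC, ∀ c, ∃ a : Fin D.degree → D.KC,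
      (∀ i, a i ∈ D.KB⟮D.t⟯) ∧ c = ∑ i, a i * e i := by
  have := D.finite_right
  obtain ⟨e, he⟩ := exists_fin_finrank_spanning_family D.KB⟮D.t⟯ D.KC
  refine ⟨e, fun c => ?_⟩
  obtain ⟨a, ha⟩ := he c
  exact ⟨fun i => a i, fun i => (a i).2, ha⟩

namespace IsFieldOfTensorProduct

variable {k K L K' : Type*} [Field k] [Field K] [Field L] [Field K']
    [Algebra k K] [Algebra k L] [Algebra k K'] [Algebra K K'] [Algebra L K']
    [IsScalarTower k K K'] [IsScalarTower k L K']

theorem algebraicIndepOn_image_left (h : IsFieldOfTensorProduct k K L K') {s : Set K}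
    (hs : AlgebraicIndepOn k id s) : AlgebraicIndepOn L id (algebraMap K K' '' s) := by
  have h1 := (algebraicIndependent_right h.symm (x := fun i : s => id (i : K)) hs).to_subtype_range
  have h2 : (Set.range fun i : s => algebraMap K K' (id (i : K))) = algebraMap K K' '' s := by
    ext; simp
  rw [h2] at h1
  exact h1

theorem algebraicIndepOn_image_right (h : IsFieldOfTensorProduct k K L K') {s : Set L}
    (hs : AlgebraicIndepOn k id s) : AlgebraicIndepOn K id (algebraMap L K' '' s) :=
  h.symm.algebraicIndepOn_image_left hs

theorem algebraicIndepOn_image_algebraMap (h : IsFieldOfTensorProduct k K L K') {V : Type*}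
    [Field V] [Algebra K' V] [Algebra K V] [Algebra L V] [IsScalarTower K K' V]
    [IsScalarTower L K' V] {s : Set L} (hs : AlgebraicIndepOn k id s) :
    AlgebraicIndepOn K id (algebraMap L V '' s) := by
  have h1 := (h.algebraicIndepOn_image_right hs).image_algHom (IsScalarTower.toAlgHom K K' V)
  rw [Set.image_image] at h1
  have h2 : (fun x => IsScalarTower.toAlgHom K K' V (algebraMap L K' x)) = algebraMap L V :=
    funext fun x => (IsScalarTower.algebraMap_apply L K' V x).symm
  rw [h2] at h1
  exact h1

/-- `K'` is generated as a field by the images of `K` and `L`. -/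
theorem map_mem_of_forall_mem (h : IsFieldOfTensorProduct k K L K') {V : Type*} [Field V]
    (f : K' →+* V) (E : Subfield V) (hK : ∀ x, f (algebraMap K K' x) ∈ E)
    (hL : ∀ x, f (algebraMap L K' x) ∈ E) (x : K') : f x ∈ E := by
  have key : ∀ a : K ⊗[k] L, f (Algebra.TensorProduct.productMap (IsScalarTower.toAlgHom k K K')
      (IsScalarTower.toAlgHom k L K') a) ∈ E := by
    intro a
    induction a using TensorProduct.induction_on with
    | zero => rw [map_zero, map_zero]; exact E.zero_mem
    | add a b ha hb => rw [map_add, map_add]; exact E.add_mem ha hb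
    | tmul u v =>
      rw [Algebra.TensorProduct.productMap_apply_tmul, map_mul]
      exact E.mul_mem (hK u) (hL v)
  obtain ⟨a, b, rfl⟩ := h.exists_div_eq x
  rw [map_div₀]
  exact E.div_mem (key a) (key b)

/-- A transcendence basis of `K/k` is a transcendence basis of `K'/L`. -/
theorem isTranscendenceBasis_image (h : IsFieldOfTensorProduct k K L K') {s : Set K}
    (hs : IsTranscendenceBasis k ((↑) : s → K)) :
    IsTranscendenceBasis L ((↑) : (algebraMap K K' '' s : Set K') → K') := by
  have hind := h.algebraicIndepOn_image_left hs.1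
  let s' : Set K' := algebraMap K K' '' s
  have hind' : AlgebraicIndependent L ((↑) : s' → K') := hind
  refine hind'.isTranscendenceBasis_iff_isAlgebraic.2 ⟨fun x => ?_⟩
  rw [Subtype.range_coe]
  refine isAlgebraic_algebra_adjoin_iff.2 ?_
  let E := (algebraicClosure (adjoin L s') K').toSubfield
  refine mem_algebraicClosure_iff.1 (h.map_mem_of_forall_mem (RingHom.id K') E (fun y => ?_)
    (fun y => ?_) x)
  · refine mem_algebraicClosure_iff.2 ?_
    have h1 := hs.isAlgebraic
    rw [Subtype.range_coe] at h1
    have h2 := isAlgebraic_adjoin_image (IsScalarTower.toAlgHom k K K')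
      (isAlgebraic_algebra_adjoin_iff.1 (h1.isAlgebraic y))
    refine isAlgebraic_of_algebraMap_mem (A := adjoin k s') (adjoin L s') (fun a => ?_) h2
    exact (adjoin_le_iff.2 (subset_adjoin L s') :
      adjoin k s' ≤ (adjoin L s').restrictScalars k) a.2
  · exact (algebraicClosure (adjoin L s') K').algebraMap_mem
      ⟨_, (adjoin L s').algebraMap_mem y⟩

/-! ### Base change of covering diagrams -/

/-- The compositum of a covering diagram of `K/k` with `L` is a covering diagram of `K'/L`. -/
theorem exists_coveringDiagram_baseChange (h : IsFieldOfTensorProduct k K L K')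
    [Algebra.EssFiniteType k K] (D : CoveringDiagram k K) :
    ∃ D' : CoveringDiagram L K', D'.degree ≤ D.degree ∧ (D.IsSeparable → D'.IsSeparable) := by
  let Ω := AlgebraicClosure K'
  have := D.finite_left
  have := D.finite_right
  let σ : D.KC →ₐ[K] Ω := IsAlgClosed.lift
  let σk : D.KC →ₐ[k] Ω := σ.restrictScalars k
  let bas := Module.finBasis K D.KC
  let w : Set Ω := Set.range fun i => σ (bas i)
  let KC : IntermediateField K' Ω := adjoin K' w
  have hσalg : ∀ c, IsAlgebraic K' (σ c) := fun c => Algebra.IsAlgebraic.isAlgebraic _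
  have hKCfin : FiniteDimensional K' KC :=
    finiteDimensional_adjoin fun x _ => Algebra.IsIntegral.isIntegral x
  have hKKC : ∀ x : K, algebraMap K Ω x ∈ KC := fun x => by
    rw [IsScalarTower.algebraMap_apply K K' Ω]
    exact KC.algebraMap_mem _
  have hσKC : ∀ c, σ c ∈ KC := by
    intro c
    rw [← bas.sum_repr c, map_sum]
    refine sum_mem fun i _ => ?_
    rw [map_smul, Algebra.smul_def]
    exact mul_mem (hKKC _) (subset_adjoin K' _ (Set.mem_range_self i))
  let B' : IntermediateField L Ω := adjoin L (σ '' D.KB)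
  let t' : Ω := σ D.t
  let N := B'⟮t'⟯
  have hBN : ∀ x ∈ B', x ∈ N := fun x hx => N.algebraMap_mem ⟨x, hx⟩
  have hLN : ∀ x : L, algebraMap L Ω x ∈ N := fun x => hBN _ (B'.algebraMap_mem x)
  have hσN : ∀ c ∈ D.KB⟮D.t⟯, σ c ∈ N := by
    intro c hc
    have hc' := mem_adjoin_union_of_mem_adjoin_simple D.KB hc
    clear hc
    induction hc' using adjoin_induction with
    | mem x hx =>
      obtain hx | rfl := hx
      · exact hBN _ (subset_adjoin L _ ⟨x, hx, rfl⟩)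
      · exact mem_adjoin_simple_self _ _
    | algebraMap x =>
      have h1 : σ (algebraMap k D.KC x) = algebraMap k Ω x := σk.commutes x
      rw [h1, IsScalarTower.algebraMap_apply k L Ω]
      exact hLN _
    | add x y _ _ hx hy => rw [map_add]; exact add_mem hx hy
    | inv x _ hx => rw [map_inv₀]; exact inv_mem hx
    | mul x y _ _ hx hy => rw [map_mul]; exact mul_mem hx hy
  obtain ⟨e, he⟩ := D.exists_spanning_family
  let e' : Fin D.degree → Ω := fun i => σ (e i)
  have hspan : ∀ c, σ c ∈ Submodule.span N (Set.range e') := by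
    intro c
    obtain ⟨a, ha, hc⟩ := he c
    rw [hc, map_sum]
    refine Submodule.sum_mem _ fun i _ => ?_
    rw [map_mul]
    exact Submodule.smul_mem _ (⟨_, hσN _ (ha i)⟩ : N)
      (Submodule.subset_span (Set.mem_range_self i))
  obtain ⟨E, hEalg, hE⟩ := exists_intermediateField_eq_span (F := N) e'
    (by have := hspan 1; rwa [map_one] at this)
    (fun i j => by have := hspan (e i * e j); rwa [map_mul] at this)
  have hK'E : ∀ x : K', algebraMap K' Ω x ∈ E := by
    refine h.map_mem_of_forall_mem (algebraMap K' Ω) E.toSubfield (fun x => ?_) (fun x => ?_)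
    · rw [← IsScalarTower.algebraMap_apply K K' Ω, ← σ.commutes x]
      exact (hE _).2 (hspan _)
    · rw [← IsScalarTower.algebraMap_apply L K' Ω]
      exact E.algebraMap_mem ⟨_, hLN x⟩
  have hKCE : ∀ x ∈ KC, x ∈ E := by
    intro x hx
    induction hx using adjoin_induction with
    | mem x hx => obtain ⟨i, rfl⟩ := hx; exact (hE _).2 (hspan _)
    | algebraMap x => exact hK'E x
    | add x y _ _ hx hy => exact add_mem hx hy
    | inv x _ hx => exact inv_mem hx
    | mul x y _ _ hx hy => exact mul_mem hx hy
  obtain ⟨s, hs⟩ := exists_isTranscendenceBasis k K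
  obtain ⟨z, hzB, hBz, hzs⟩ := D.exists_encard_add_one_eq hs
  have htr : Transcendental B' t' := by
    intro ht
    -- Otherwise `K'` would be algebraic over `L(z)`, where `z` is too small.
    let z' : Set Ω := σ '' z
    have hB' : ∀ x ∈ B', IsAlgebraic (adjoin L z') x := by
      refine fun x hx => isAlgebraic_of_mem_adjoin ?_ hx
      rintro _ ⟨b, hb, rfl⟩
      have h1 : IsAlgebraic (adjoin k z') (σ b) := isAlgebraic_adjoin_image σk (hBz b hb)
      refine isAlgebraic_of_algebraMap_mem (A := adjoin k z') (adjoin L z') (fun a => ?_) h1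
      exact (adjoin_le_iff.2 (subset_adjoin L z') :
        adjoin k z' ≤ (adjoin L z').restrictScalars k) a.2
    have ht' : IsAlgebraic (adjoin L z') t' :=
      isAlgebraic_of_isAlgebraic_adjoin (S := σ '' D.KB)
        (fun x hx => hB' x (subset_adjoin L _ hx)) ht
    have hK'z : ∀ x : K', IsAlgebraic (adjoin L z') (algebraMap K' Ω x) := by
      intro x
      have h3 : IsAlgebraic N (algebraMap K' Ω x) := hEalg _ (hK'E x)
      have h4 : IsAlgebraic (adjoin L ((B' : Set Ω) ∪ {t'})) (algebraMap K' Ω x) :=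
        isAlgebraic_of_algebraMap_mem (A := N) _
          (fun a => mem_adjoin_union_of_mem_adjoin_simple B' a.2) h3
      refine isAlgebraic_of_isAlgebraic_adjoin (N := adjoin L z') ?_ h4
      rintro u (hu | rfl)
      · exact hB' u hu
      · exact ht'
    have hinj : Function.Injective (IsScalarTower.toAlgHom L K' Ω) := RingHom.injective _
    have h5 : (IsScalarTower.toAlgHom L K' Ω '' (algebraMap K K' '' s)).encard ≤ z'.encard :=
      encard_le_of_isAlgebraic_adjoin ((h.algebraicIndepOn_image_left hs.1).image_algHom _) (by
        rintro _ ⟨x, -, rfl⟩; exact hK'z x)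
    rw [hinj.encard_image, (algebraMap K K').injective.encard_image, ← hzs] at h5
    have hzfin : z.Finite := by
      rw [← Set.encard_lt_top_iff]
      refine lt_of_le_of_lt le_self_add (b := z.encard + 1) ?_
      rw [hzs]
      exact hs.finite_of_essFiniteType.encard_lt_top
    exact absurd (h5.trans (Set.encard_image_le _ _))
      (not_le.2 ((ENat.lt_add_one_iff hzfin.encard_lt_top.ne).2 le_rfl))
  obtain ⟨D', hD', hD's⟩ := CoveringDiagram.exists_degree_le (k := L) KC B'
    (by
      have : B' ≤ KC.restrictScalars L := adjoin_le_iff.2 (by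
        rintro _ ⟨b, -, rfl⟩; exact hσKC b)
      exact this)
    (hσKC D.t) htr e' fun x hx => (hE x).1 (hKCE x hx)
  rw [Fintype.card_fin] at hD'
  refine ⟨D', hD', fun hse => hD's ((isSeparable_adjoin_iff_isSeparable K' Ω).2 ?_)⟩
  rintro _ ⟨i, rfl⟩
  have : Algebra.IsSeparable K D.KC := hse
  exact IsSeparable.map_ringHom (algebraMap K K') σ.toRingHom
    (RingHom.ext fun x => ((IsScalarTower.algebraMap_apply K K' Ω x).symm.trans
      (σ.commutes x).symm)) (Algebra.IsSeparable.isSeparable K (bas i))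

/-- A covering diagram of `K'/L` specializes to one of `K/k`, provided that every finite part of `L`
is algebraic over `k(X)`, and separable over `K(X)` in the separable case, for some set `X` that is
algebraically independent over `K`. -/
theorem exists_coveringDiagram_descent (h : IsFieldOfTensorProduct k K L K')
    [Algebra.EssFiniteType k K] (D : CoveringDiagram L K') {V : Type*} [Field V] [IsAlgClosed V]
    [Algebra K' V] [Algebra K V] [Algebra L V] [Algebra k V] [IsScalarTower K K' V]
    [IsScalarTower L K' V] [IsScalarTower k K V] [IsScalarTower k L V] (sep : Prop)
    (hsepD : sep → D.IsSeparable)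
    (hL : ∀ l : Finset V, (l : Set V) ⊆ Set.range (algebraMap L V) → ∃ X : Set V,
      AlgebraicIndepOn K id X ∧ (∀ x ∈ l, IsAlgebraic (adjoin k X) x) ∧
        (sep → ∀ x ∈ l, IsSeparable (adjoin K X) x)) :
    ∃ D' : CoveringDiagram k K, D'.degree ≤ D.degree ∧ (sep → D'.IsSeparable) := by
  have := D.finite_left
  have := D.finite_right
  let σ : D.KC →ₐ[K'] V := IsAlgClosed.lift
  let σL : D.KC →ₐ[L] V := σ.restrictScalars L
  let B : Set V := σ '' D.KB
  let t : V := σ D.t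
  obtain ⟨e, he⟩ := D.exists_spanning_family
  let e' : Fin D.degree → V := fun i => σ (e i)
  obtain ⟨s, hs⟩ := exists_isTranscendenceBasis k K
  obtain ⟨z, hzB, hBz, hzs⟩ := D.exists_encard_add_one_eq (h.isTranscendenceBasis_image hs)
  rw [(algebraMap K K').injective.encard_image] at hzs
  have hzfin : z.Finite := by
    rw [← Set.encard_lt_top_iff]
    refine lt_of_le_of_lt le_self_add (b := z.encard + 1) ?_
    rw [hzs]
    exact hs.finite_of_essFiniteType.encard_lt_top
  have hσinj : Function.Injective σ := RingHom.injective _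
  let L' : Set V := Set.range (algebraMap L V)
  have hK' : ∀ x : K', algebraMap K' V x ∈ adjoin K L' := by
    refine h.map_mem_of_forall_mem (algebraMap K' V) (adjoin K L').toSubfield (fun x => ?_)
      (fun x => ?_)
    · rw [← IsScalarTower.algebraMap_apply K K' V]
      exact (adjoin K L').algebraMap_mem x
    · rw [← IsScalarTower.algebraMap_apply L K' V]
      exact subset_adjoin K L' ⟨x, rfl⟩
  have hσ : ∀ x ∈ insert t (B ∪ σ '' z ∪ Set.range e'), ∃ c, σ c = x := by
    rintro x (rfl | (⟨c, -, rfl⟩ | ⟨c, -, rfl⟩) | ⟨i, rfl⟩) <;> exact ⟨_, rfl⟩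
  have hσN : ∀ c ∈ D.KB⟮D.t⟯, σ c ∈ adjoin k (B ∪ {t}) := by
    intro c hc
    have hc' := mem_adjoin_union_of_mem_adjoin_simple D.KB hc
    clear hc
    induction hc' using adjoin_induction with
    | mem x hx =>
      obtain hx | rfl := hx
      · exact subset_adjoin k _ (Or.inl ⟨x, hx, rfl⟩)
      · exact subset_adjoin k _ (Or.inr rfl)
    | algebraMap x => exact subset_adjoin k _ (Or.inl ⟨_, D.KB.algebraMap_mem x, rfl⟩)
    | add x y _ _ hx hy => rw [map_add]; exact add_mem hx hy
    | inv x _ hx => rw [map_inv₀]; exact inv_mem hx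
    | mul x y _ _ hx hy => rw [map_mul]; exact mul_mem hx hy
  have hspan : ∀ c, σ c ∈ Submodule.span (adjoin k (B ∪ {t})) (Set.range e') := by
    intro c
    obtain ⟨a, ha, hc⟩ := he c
    rw [hc, map_sum]
    refine Submodule.sum_mem _ fun i _ => ?_
    rw [map_mul]
    exact Submodule.smul_mem _ (⟨_, hσN _ (ha i)⟩ : adjoin k (B ∪ {t}))
      (Submodule.subset_span (Set.mem_range_self i))
  obtain ⟨D', hD', hD's⟩ := exists_coveringDiagram_of_specialization (k := k) sep (L := L')
    (B := B) (z := σ '' z) (t := t) e' (hzfin.image _) hs.1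
    (by rw [hσinj.encard_image, hzs])
    (by
      intro x hx
      obtain ⟨c, rfl⟩ := hσ x hx
      exact isAlgebraic_of_algebraMap_mem (A := K') _ hK'
        ((Algebra.IsAlgebraic.isAlgebraic (R := K') c).algHom σ))
    (by
      intro hse x hx
      obtain ⟨c, rfl⟩ := hσ x hx
      have : Algebra.IsSeparable K' D.KC := hsepD hse
      exact isSeparable_of_algebraMap_mem (A := K') _ hK'
        ((Algebra.IsSeparable.isSeparable K' c).map σ hσinj))
    (by
      rintro _ ⟨b, hb, rfl⟩
      have h1 : IsAlgebraic (adjoin L (σ '' z)) (σ b) := isAlgebraic_adjoin_image σL (hBz b hb)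
      refine isAlgebraic_of_algebraMap_mem (A := adjoin L (σ '' z)) _ (fun a => ?_) h1
      obtain ⟨a, ha⟩ := a
      change a ∈ _
      induction ha using adjoin_induction with
      | mem x hx => exact subset_adjoin k _ (Or.inr hx)
      | algebraMap x => exact subset_adjoin k _ (Or.inl ⟨x, rfl⟩)
      | add x y _ _ hx hy => exact add_mem hx hy
      | inv x _ hx => exact inv_mem hx
      | mul x y _ _ hx hy => exact mul_mem hx hy)
    (by have := hspan 1; rwa [map_one] at this)
    (fun i j => by have := hspan (e i * e j); rwa [map_mul] at this)
    (fun x => by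
      have := hspan (algebraMap K' D.KC (algebraMap K K' x))
      rwa [σ.commutes, ← IsScalarTower.algebraMap_apply K K' V] at this)
    hL
  rw [Fintype.card_fin] at hD'
  exact ⟨D', hD', hD's⟩

end IsFieldOfTensorProduct

/-! ### Invariance of the covering gonality -/

namespace IsFieldOfTensorProduct

variable {k K L K' : Type*} [Field k] [Field K] [Field L] [Field K']
    [Algebra k K] [Algebra k L] [Algebra k K'] [Algebra K K'] [Algebra L K']
    [IsScalarTower k K K'] [IsScalarTower k L K']

/-- If `L` lies in a separable extension `M` of an algebraic extension `F ⊆ K` of `k`, then every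
finite part of `L` is separable over `F(X)` for some set `X` algebraically independent over `K`. -/
theorem exists_algebraicIndepOn_isSeparable (h : IsFieldOfTensorProduct k K L K')
    {F : IntermediateField k K} (hF : ∀ x ∈ F, IsAlgebraic k x) {M : Type*} [Field M]
    [Algebra F M] (hM : IsSeparableExtension F M) {V : Type*} [Field V]
    [Algebra K' V] [Algebra K V] [Algebra L V] [Algebra k V] [IsScalarTower K K' V]
    [IsScalarTower L K' V] [IsScalarTower k K V] [IsScalarTower k L V] (j : M →ₐ[F] V)
    (hj : ∀ x : L, ∃ m, j m = algebraMap L V x) (l : Finset V)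
    (hl : (l : Set V) ⊆ Set.range (algebraMap L V)) :
    ∃ X : Set V, AlgebraicIndepOn K id X ∧ (∀ x ∈ l, IsAlgebraic (adjoin k X) x) ∧
      ∀ x ∈ l, IsSeparable (adjoin K X) x := by
  have hm : ∀ v ∈ l, ∃ m, j m = v := fun v hv => by
    obtain ⟨x, rfl⟩ := hl hv
    exact hj x
  choose! m hm using hm
  let E := adjoin F (m '' (l : Set V))
  obtain ⟨s, hs, hsep⟩ := hM E (fg_adjoin_of_finite (l.finite_toSet.image m))
  let f : E →ₐ[F] V := j.comp E.val
  let X : Set V := f '' s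
  have hlF : ∀ v ∈ l, IsSeparable (adjoin F X) v := by
    intro v hv
    have h1 : f ⟨m v, subset_adjoin F _ ⟨v, hv, rfl⟩⟩ = v := hm v hv
    rw [← h1]
    exact isSeparable_adjoin_image f (Algebra.IsSeparable.isSeparable (adjoin F s) _)
  have hFK : ∀ a : adjoin F X, algebraMap (adjoin F X) V a ∈ adjoin K X := by
    rintro ⟨a, ha⟩
    change a ∈ adjoin K X
    induction ha using adjoin_induction with
    | mem x hx => exact subset_adjoin K _ hx
    | algebraMap x => exact (adjoin K X).algebraMap_mem x
    | add x y _ _ hx hy => exact add_mem hx hy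
    | inv x _ hx => exact inv_mem hx
    | mul x y _ _ hx hy => exact mul_mem hx hy
  have hlK : ∀ v ∈ l, IsSeparable (adjoin K X) v := fun v hv =>
    isSeparable_of_algebraMap_mem (A := adjoin F X) _ hFK (hlF v hv)
  refine ⟨X, ?_, fun v hv => ?_, hlK⟩
  · -- Compare `X` with a maximal part `Y` of `l` that is algebraically independent over `k`.
    obtain ⟨Y₀, hY₀⟩ := (AlgebraicIndependent.matroid k L).exists_isBasis
      (algebraMap L V ⁻¹' (l : Set V))
    obtain ⟨hY₀i, hY₀l, hY₀a⟩ := AlgebraicIndependent.matroid_isBasis_iff.1 hY₀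
    let Y : Set V := algebraMap L V '' Y₀
    have hYl : Y ⊆ l := by rintro _ ⟨y, hy, rfl⟩; exact hY₀l hy
    have hY : AlgebraicIndepOn K id Y := h.algebraicIndepOn_image_algebraMap hY₀i
    have hlY : ∀ v ∈ l, IsAlgebraic (adjoin F Y) v := by
      intro v hv
      obtain ⟨x, rfl⟩ := hl hv
      have h1 := isAlgebraic_adjoin_image (IsScalarTower.toAlgHom k L V)
        (isAlgebraic_algebra_adjoin_iff.1 (hY₀a x hv))
      refine isAlgebraic_of_algebraMap_mem (A := adjoin k Y) (adjoin F Y) ?_ h1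
      rintro ⟨a, ha⟩
      change a ∈ adjoin F Y
      induction ha using adjoin_induction with
      | mem x hx => exact subset_adjoin F _ hx
      | algebraMap x =>
        have : algebraMap k V x = algebraMap F V (algebraMap k F x) :=
          IsScalarTower.algebraMap_apply k K V x
        rw [this]
        exact (adjoin F Y).algebraMap_mem _
      | add x y _ _ hx hy => exact add_mem hx hy
      | inv x _ hx => exact inv_mem hx
      | mul x y _ _ hx hy => exact mul_mem hx hy
    have hE : ∀ x : E, IsAlgebraic (adjoin F Y) (f x) := by
      rintro ⟨x, hx⟩
      have h1 : j x ∈ adjoin F (l : Set V) := by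
        have h2 : E ≤ (adjoin F (l : Set V)).comap j := by
          refine adjoin_le_iff.2 ?_
          rintro _ ⟨v, hv, rfl⟩
          change j (m v) ∈ adjoin F (l : Set V)
          rw [hm v hv]
          exact subset_adjoin F _ hv
        exact h2 hx
      exact isAlgebraic_of_mem_adjoin hlY h1
    have hXY : X.encard ≤ Y.encard := encard_le_of_isAlgebraic_adjoin
      (AlgebraicIndepOn.image_algHom f hs.1) (by
      rintro _ ⟨x, -, rfl⟩; exact hE x)
    have hXfin : X.Finite := Set.encard_lt_top_iff.1 (hXY.trans_lt
      (l.finite_toSet.subset hYl).encard_lt_top)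
    exact algebraicIndepOn_of_encard_le hXfin hY
      (fun y hy => (hlK y (hYl hy)).isIntegral.isAlgebraic) hXY
  · have h1 : IsAlgebraic (adjoin k (Set.range (algebraMap F V) ∪ X)) v := by
      refine isAlgebraic_of_algebraMap_mem (A := adjoin F X) _ ?_
        (hlF v hv).isIntegral.isAlgebraic
      rintro ⟨a, ha⟩
      change a ∈ _
      induction ha using adjoin_induction with
      | mem x hx => exact subset_adjoin k _ (Or.inr hx)
      | algebraMap x => exact subset_adjoin k _ (Or.inl ⟨x, rfl⟩)
      | add x y _ _ hx hy => exact add_mem hx hy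
      | inv x _ hx => exact inv_mem hx
      | mul x y _ _ hx hy => exact mul_mem hx hy
    refine isAlgebraic_of_isAlgebraic_adjoin (N := adjoin k X) ?_ h1
    rintro x (⟨x, rfl⟩ | hx)
    · have h2 : IsAlgebraic k (IsScalarTower.toAlgHom k K V x) := (hF x x.2).algHom _
      exact h2.tower_top (adjoin k X)
    · exact isAlgebraic_algebraMap (⟨x, subset_adjoin k X hx⟩ : adjoin k X)

theorem cvg_le (h : IsFieldOfTensorProduct k K L K') [Algebra.EssFiniteType k K] :
    cvg k K ≤ cvg L K' := by
  refine le_iInf fun D => ?_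
  obtain ⟨s, hs⟩ := exists_isTranscendenceBasis k L
  let V := AlgebraicClosure K'
  have hX : AlgebraicIndepOn K id (algebraMap L V '' s) :=
    h.algebraicIndepOn_image_algebraMap hs.1
  have hLX : ∀ x : L, IsAlgebraic (adjoin k (algebraMap L V '' s)) (algebraMap L V x) := by
    intro x
    have h1 := hs.isAlgebraic
    rw [Subtype.range_coe] at h1
    exact isAlgebraic_adjoin_image (IsScalarTower.toAlgHom k L V)
      (isAlgebraic_algebra_adjoin_iff.1 (h1.isAlgebraic x))
  obtain ⟨D', hD', -⟩ := h.exists_coveringDiagram_descent D (V := V) False False.elim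
    fun l hl => ⟨algebraMap L V '' s, hX, fun x hx => by
      obtain ⟨x, rfl⟩ := hl hx
      exact hLX x, False.elim⟩
  exact (iInf_le _ D').trans (by exact_mod_cast hD')

end IsFieldOfTensorProduct

theorem mainTheorem5 {k K L K' : Type*} [Field k] [Field K] [Field L] [Field K']
    [Algebra k K] [Algebra k L] [Algebra k K'] [Algebra K K'] [Algebra L K']
    [IsScalarTower k K K'] [IsScalarTower k L K']
    [Algebra.EssFiniteType k K]
    (hK' : IsFieldOfTensorProduct k K L K') :
    cvg k K = cvg L K' ∧
    ∀ {Ω : Type*} [Field Ω] [Algebra K' Ω] [Algebra K Ω] [IsScalarTower K K' Ω]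
      (M : IntermediateField (algebraicClosure k K) Ω),
      IsSeparableExtension (algebraicClosure k K) M →
      (∀ x : L, algebraMap K' Ω (algebraMap L K' x) ∈ M) →
      scvg k K = scvg L K' := by
  refine ⟨le_antisymm hK'.cvg_le (le_iInf fun D => ?_), ?_⟩
  · obtain ⟨D', hD', -⟩ := hK'.exists_coveringDiagram_baseChange D
    exact (iInf_le _ D').trans (by exact_mod_cast hD')
  intro Ω _ _ _ _ M hM hLM
  refine le_antisymm (le_iInf₂ fun D hD => ?_) (le_iInf₂ fun D hD => ?_)
  · let _ : Algebra L Ω := ((algebraMap K' Ω).comp (algebraMap L K')).toAlgebra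
    let _ : Algebra k Ω := ((algebraMap K' Ω).comp (algebraMap k K')).toAlgebra
    have : IsScalarTower L K' Ω := IsScalarTower.of_algebraMap_eq fun _ => rfl
    have : IsScalarTower k K' Ω := IsScalarTower.of_algebraMap_eq fun _ => rfl
    have : IsScalarTower k K Ω := IsScalarTower.to₁₂₄ k K K' Ω
    have : IsScalarTower k L Ω := IsScalarTower.to₁₂₄ k L K' Ω
    let V := AlgebraicClosure Ω
    let j : M →ₐ[algebraicClosure k K] V :=
      { toRingHom := (algebraMap Ω V).comp M.val.toRingHom
        commutes' := fun _ => rfl }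
    obtain ⟨D', hD', hD's⟩ := hK'.exists_coveringDiagram_descent D (V := V) True (fun _ => hD)
      fun l hl => by
        obtain ⟨X, hX, h1, h2⟩ := hK'.exists_algebraicIndepOn_isSeparable
          (fun x hx => mem_algebraicClosure_iff.1 hx) hM j (fun x => ⟨⟨_, hLM x⟩, rfl⟩) l hl
        exact ⟨X, hX, h1, fun _ => h2⟩
    exact (iInf₂_le D' (hD's trivial)).trans (by exact_mod_cast hD')
  · obtain ⟨D', hD', hD's⟩ := hK'.exists_coveringDiagram_baseChange D
    exact (iInf₂_le D' (hD's hD)).trans (by exact_mod_cast hD')
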